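/- Let $\mathbb{R}_+=\,]0,\infty[$, and let $K$ be the bounded operator on $L^2(\mathbb{R}_+)$ (complex-valued functions) given by $$(Kg)(x)=\int_0^\infty \tfrac1\pi\operatorname{sinc}(x-y)\,g(y)\,dy ,\qquad \operatorname{sinc}(x)=\tfrac{\sin x}{x},\ \operatorname{sinc}(0)=1,$$ where the integral exists for every $x>0$. Let $\mathcal{F}_c$, $\mathcal{F}_s$ and $\mathcal{H}_\nu$ denote the Fourier cosine, the Fourier sine and the Hankel transformation on $L^2(\mathbb{R}_+)$, i.e. the bounded operators $$g\mapsto \operatorname{l.i.m.}_{A\to\infty}\int_0^A \kappa(\cdot,y)\,g(y)\,dy$$ (limit in $L^2(\mathbb{R}_+)$ for every $g$) with kernel $\kappa(s,y)=\sqrt{2/\pi}\cos(sy)$, $\sqrt{2/\pi}\sin(sy)$ and $(sy)^{1/2}J_\nu(sy)$, respectively, where $$J_\nu(z)=\Big(\frac z2\Big)^{\nu}\sum_{k=0}^\infty\frac{(-1)^k}{k!\,\Gamma(\nu+k+1)}\Big(\frac z2\Big)^{2k}$$ is the Bessel function of the first kind (principal branch). Let $M(1_{[0,1]})$ be multiplication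 by the indicator function of $[0,1]$ on $L^2(\mathbb{R}_+)$. For $\nu\in\frac12+\mathbb{N}_0$ let $\psi_\nu(s)=(2\nu)^{1/2}s^{-1/2}J_\nu(s)$ and let $P(\nu)$ be the orthogonal projection of $L^2(\mathbb{R}_+)$ onto the span of $\psi_\nu$. These objects are well defined: $K$, $\mathcal{F}_c$, $\mathcal{F}_s$ and $\mathcal{H}_\nu$, $\nu\in-\frac12+\mathbb{N}_0$, exist as bounded operators, and $\psi_\nu\in L^2(\mathbb{R}_+)$ for $\nu\in\frac12+\mathbb{N}_0$. Moreover: (i) $K=\frac12\big(\mathcal{F}_cM(1_{[0,1]})\mathcal{F}_c+\mathcal{F}_sM(1_{[0,1]})\mathcal{F}_s\big)$. (ii) $\mathcal{F}_cM(1_{[0,1]})\mathcal{F}_c=\bigoplus_{n\in\mathbb{N}_0}P(2n+\frac12)$ and $\mathcal{F}_sM(1_{[0,1]})\mathcal{F}_s=\bigoplus_{n\in\mathbb{N}_0}P(2n+\frac32)$; that is, each of the families $(\psi_{2n+1/2})_{n\in\mathbb{N}_0}$ and $(\psi_{2n+3/2})_{n\in\mathbb{N}_0}$ is orthonormal, and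 the respective sum of projections converges strongly to the operator on the left. (iii) For all $n\in\mathbb{N}_0$ and $i\in\{0,1\}$, $$\mathcal{H}_{2n+i+1/2}M(1_{[0,1]})\mathcal{H}_{2n+i+1/2}=\mathcal{H}_{1/2-i}M(1_{[0,1]})\mathcal{H}_{1/2-i}-\sum_{k=0}^{n-1+i}P(2k-i+\tfrac32).$$ (iv) For $\nu,a,b,z\in\mathbb{C}$ with $ab\neq0$ and integers $n\le n'$, where either $\nu\in\mathbb{Z}$ or $az,bz\in\mathbb{C}\setminus\,]-\infty,0]$, $$\frac{d}{dz}\sum_{k=n}^{n'}\frac{2(\nu+2k)}{ab}J_{\nu+2k}(az)J_{\nu+2k}(bz)=z\big(J_{\nu+2n-1}(az)J_{\nu+2n-1}(bz)-J_{\nu+2n'+1}(az)J_{\nu+2n'+1}(bz)\big).$$ -/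

import Mathlib

open MeasureTheory Filter Set
open scoped Topology ENNReal Nat

noncomputable section

/-- Lebesgue measure on the open half-line `]0, ∞[`. -/
abbrev posMeasure : Measure ℝ := volume.restrict (Ioi (0 : ℝ))

/-- The complex Hilbert space `L²(ℝ₊)`, where `ℝ₊ = ]0, ∞[`. -/
abbrev L2Pos : Type := Lp ℂ 2 posMeasure

/-- The Bessel function of the first kind of complex order, on the principal branch:
`J_ν(z) = (z/2)^ν ∑ₖ (-1)ᵏ / (k! Γ(ν + k + 1)) (z/2)^(2k)`. The reciprocal Gamma function vanishes
at the poles of `Γ`, in agreement with the value `0` that `Complex.Gamma` and `⁻¹` take there. -/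
def besselJ (ν z : ℂ) : ℂ :=
  (z / 2) ^ ν *
    ∑' k : ℕ, (-1 : ℂ) ^ k * ((k ! : ℂ) * Complex.Gamma (ν + k + 1))⁻¹ * (z / 2) ^ (2 * k)

/-- `T` is the integral operator on `L²(ℝ₊)` with kernel `k`: for every `g` the integral
`∫₀^∞ k(x,y) g(y) dy` exists for every `x > 0`, and it equals `(T g)(x)` for almost every `x`. -/
def IsIntegralOperator (k : ℝ → ℝ → ℂ) (T : L2Pos →L[ℂ] L2Pos) : Prop :=
  ∀ g : L2Pos,
    (∀ x : ℝ, 0 < x → IntegrableOn (fun y : ℝ => k x y * g y) (Ioi 0)) ∧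
    ∀ᵐ x ∂posMeasure, T g x = ∫ y in Ioi (0 : ℝ), k x y * g y

/-- `T` is the integral transformation on `L²(ℝ₊)` with kernel `k` in the sense of limits in the
mean: for every `g`, the functions `s ↦ ∫₀^A k(s,y) g(y) dy` converge to `T g` in `L²(ℝ₊)` as
`A → ∞`. -/
def IsMeanIntegralTransform (k : ℝ → ℝ → ℂ) (T : L2Pos →L[ℂ] L2Pos) : Prop :=
  ∀ g : L2Pos,
    Tendsto
      (fun A : ℝ => eLpNorm (fun s : ℝ => (∫ y in Ioc (0 : ℝ) A, k s y * g y) - T g s) 2 posMeasure)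
      atTop (𝓝 0)

open Classical in
/-- The integral operator with kernel `k`, if it exists as a bounded operator (it is then unique);
otherwise `0`. -/
def integralOperator (k : ℝ → ℝ → ℂ) : L2Pos →L[ℂ] L2Pos :=
  if h : ∃ T, IsIntegralOperator k T then h.choose else 0

open Classical in
/-- The integral transformation with kernel `k` in the sense of limits in the mean, if it exists as
a bounded operator (it is then unique); otherwise `0`. -/
def meanIntegralTransform (k : ℝ → ℝ → ℂ) : L2Pos →L[ℂ] L2Pos :=
  if h : ∃ T, IsMeanIntegralTransform k T then h.choose else 0

/-- The kernel `(1/π) sinc(x - y)`. -/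
def sincKernel (x y : ℝ) : ℂ := ((1 / Real.pi * Real.sinc (x - y) : ℝ) : ℂ)

/-- The kernel `√(2/π) cos(s y)`. -/
def cosKernel (s y : ℝ) : ℂ := ((√(2 / Real.pi) * Real.cos (s * y) : ℝ) : ℂ)

/-- The kernel `√(2/π) sin(s y)`. -/
def sinKernel (s y : ℝ) : ℂ := ((√(2 / Real.pi) * Real.sin (s * y) : ℝ) : ℂ)

/-- The kernel `(s y)^(1/2) J_ν(s y)`. -/
def hankelKernel (ν s y : ℝ) : ℂ := (√(s * y) : ℂ) * besselJ ν ((s * y : ℝ) : ℂ)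

/-- The Wiener-Hopf operator with kernel `(1/π) sinc`. -/
def sincOperator : L2Pos →L[ℂ] L2Pos := integralOperator sincKernel

/-- The Fourier cosine transformation on `L²(ℝ₊)`. -/
def fourierCos : L2Pos →L[ℂ] L2Pos := meanIntegralTransform cosKernel

/-- The Fourier sine transformation on `L²(ℝ₊)`. -/
def fourierSin : L2Pos →L[ℂ] L2Pos := meanIntegralTransform sinKernel

/-- The Hankel transformation of order `ν` on `L²(ℝ₊)`. -/
def hankel (ν : ℝ) : L2Pos →L[ℂ] L2Pos := meanIntegralTransform (hankelKernel ν)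

/-- The multiplication operator `M(κ)` on `L²(ℝ₊)` for `κ ∈ L^∞(ℝ₊)`. -/
def mulOperator (κ : Lp ℂ ∞ posMeasure) : L2Pos →L[ℂ] L2Pos :=
  (ContinuousLinearMap.mul ℂ ℂ).holderL posMeasure ∞ 2 2 κ

theorem posMeasure_Icc_ne_top : posMeasure (Icc 0 1) ≠ ∞ :=
  ((Measure.restrict_apply_le _ _).trans_lt measure_Icc_lt_top).ne

/-- The multiplication operator `M(1_{[0,1]})` on `L²(ℝ₊)`. -/
def unitCutoff : L2Pos →L[ℂ] L2Pos :=
  mulOperator (indicatorConstLp ∞ measurableSet_Icc posMeasure_Icc_ne_top 1)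

/-- The function `s ↦ (2ν)^(1/2) s^(-1/2) J_ν(s)`. -/
def besselFun (ν s : ℝ) : ℂ := (√(2 * ν) : ℂ) * ((√s)⁻¹ : ℂ) * besselJ ν (s : ℂ)

open Classical in
/-- The class in `L²(ℝ₊)` of `besselFun ν` (and `0` if that function is not square integrable). -/
def besselVec (ν : ℝ) : L2Pos :=
  if h : MemLp (besselFun ν) 2 posMeasure then h.toLp else 0

/-- The orthogonal projection `P(ν)` of `L²(ℝ₊)` onto the span of `s ↦ s^(-1/2) J_ν(s)`. -/
def besselProj (ν : ℝ) : L2Pos →L[ℂ] L2Pos :=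
  (Submodule.span ℂ {besselVec ν}).starProjection

end

/-!
Write `φ_m(x) = √x J_{m-1/2}(x)`, so that the Hankel transformation of order `m - 1/2` has the
kernel `φ_m(s y)`; for `m = 0, 1` this is the cosine and the sine transformation. Everything rests
on the contiguous relations `J_{ν-1} - J_{ν+1} = 2 J_ν'` and `J_{ν-1} + J_{ν+1} = (2ν/z) J_ν`,
which are read off the power series (`hasDerivAt_besselJ`, `self_mul_besselJ`). They give the
telescoping identity at once, and, integrated over `[0, A]`,

  `∫₀^A (φ_m(xt) φ_m(yt) - φ_{m+2}(xt) φ_{m+2}(yt)) dt = A ψ(Ax) ψ(Ay)`,  `ψ = ψ_{m+1/2}`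

(`integral_hankelFun_mul_sub`): raising the order by two changes the kernel of the transform, cut
off and transformed again, by a kernel of rank one.

*Existence and isometry.* For `m = 0, 1` Plancherel's theorem, applied to the even and the odd
continuation, shows that the truncated transforms are contractions of `L²` and that their limit is
isometric. By the rank-one identity, `∫₀^A |H_m g|² - ∫₀^A |H_{m+2} g|² = A |∫ ψ(Ay) g(y) dy|²`.
This is nonnegative, so `H_{m+2}` is a contraction if `H_m` is isometric, and it is `O(1/A)` if
`g` is supported in a compact subset of `]0, ∞[`, because `ψ(x) = O(1/x)`; so `H_{m+2}` is
isometric as well (`exists_isometry_hankelFun`). The kernel is real and symmetric, hence `H_m` is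
a self-adjoint isometry and `H_m² = 1`.

*Orthonormality and completeness.* With `M` the multiplication by the indicator function of
`[0, 1]`, the operators `Q_m = H_m M H_m` are orthogonal projections and `Q_m - Q_{m+2} = ⟪ψ, ·⟫ ψ`
(`hankelCutoff_sub`). A difference of comparable projections is a projection, so the
`ψ_{m+2n+1/2}` are orthonormal (`orthonormal_of_projection_chain`), without any integral of a
product of Bessel functions being computed. Iteration expresses `Q_{m+2N}` by `Q_m` and `N`
projections. Finally `|φ_m(x)| ≤ |x|^m / m!`, so that `Q_m → 0` strongly as `m → ∞`
(`tendsto_hankelCutoff`), and the sum of the projections is `Q_0` or `Q_1`.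

*The sinc kernel.* `(Q_0 + Q_1) / 2` has the kernel `(1/π) ∫₀¹ cos((x - y)t) dt`, which equals
`(1/π) sinc(x - y)`, on functions of bounded support; the general case follows by an almost
everywhere convergent subsequence of truncations.
-/

/-! ### The entire part of the Bessel functions -/

/-- The coefficients of the power series `∑ₖ (-1)ᵏ / (k! Γ(ν + k + 1)) wᵏ`. -/
noncomputable def besselCoeff (ν : ℂ) (k : ℕ) : ℂ :=
  (-1 : ℂ) ^ k * ((k ! : ℂ) * Complex.Gamma (ν + k + 1))⁻¹

/-- The entire function `E_ν(w) = ∑ₖ (-1)ᵏ / (k! Γ(ν + k + 1)) wᵏ`, so that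
`J_ν(z) = (z/2)^ν E_ν((z/2)²)`. -/
noncomputable def besselEntire (ν w : ℂ) : ℂ := ∑' k : ℕ, besselCoeff ν k * w ^ k

theorem besselJ_eq (ν z : ℂ) : besselJ ν z = (z / 2) ^ ν * besselEntire ν ((z / 2) ^ 2) := by
  simp only [besselJ, besselEntire, besselCoeff, pow_mul]

theorem besselCoeff_sub_one (ν : ℂ) (k : ℕ) :
    besselCoeff (ν - 1) k = (ν + k) * besselCoeff ν k := by
  have h := Complex.one_div_Gamma_eq_self_mul_one_div_Gamma_add_one (ν + k)
  rw [besselCoeff, besselCoeff, show ν - 1 + k + 1 = ν + k by ring, mul_inv, mul_inv, h]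
  ring

theorem succ_mul_besselCoeff_succ (ν : ℂ) (k : ℕ) :
    (k + 1 : ℂ) * besselCoeff ν (k + 1) = -besselCoeff (ν + 1) k := by
  have hk : (k + 1 : ℂ) ≠ 0 := by exact_mod_cast k.succ_ne_zero
  rw [besselCoeff, besselCoeff, Nat.factorial_succ]
  push_cast
  rw [show ν + (k + 1 : ℂ) + 1 = ν + 1 + k + 1 by ring, mul_inv, mul_inv, mul_inv, pow_succ]
  field_simp

/-- The series defining `E_ν` converges everywhere, by the ratio test. The recursion is solved for
the earlier coefficient, since coefficients may vanish when `ν` is a negative integer. -/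
theorem summable_norm_besselCoeff (ν w : ℂ) : Summable fun k : ℕ => ‖besselCoeff ν k * w ^ k‖ := by
  refine Summable.norm (summable_of_ratio_norm_eventually_le (r := 1 / 2) (by norm_num) ?_)
  filter_upwards [eventually_ge_atTop ⌈‖ν‖ + 2 * ‖w‖⌉₊] with k hk
  have hk' : ‖ν‖ + 2 * ‖w‖ ≤ k := Nat.ceil_le.mp hk
  have hrec : besselCoeff ν k = -((k + 1) * (ν + k + 1) * besselCoeff ν (k + 1)) := by
    have h1 := succ_mul_besselCoeff_succ ν k
    have h2 := besselCoeff_sub_one (ν + 1) k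
    rw [add_sub_cancel_right] at h2
    linear_combination h2 + (ν + k + 1) * h1
  have hlow : 2 * ‖w‖ ≤ ‖ν + k + 1‖ := by
    have h3 := norm_sub_norm_le ((k : ℂ) + 1) (-ν)
    have h4 : ‖(k : ℂ) + 1‖ = k + 1 := by
      rw [← Nat.cast_succ, Complex.norm_natCast]; push_cast; rfl
    rw [h4, norm_neg, sub_neg_eq_add, show (k : ℂ) + 1 + ν = ν + k + 1 by ring] at h3
    linarith
  have hk1 : ‖(k : ℂ) + 1‖ = k + 1 := by
    rw [← Nat.cast_succ, Complex.norm_natCast]; push_cast; rfl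
  rw [hrec, pow_succ, norm_mul, norm_mul, norm_mul, norm_neg, norm_mul, norm_mul, hk1]
  have h5 : 2 * ‖w‖ ≤ (k + 1) * ‖ν + k + 1‖ := by
    nlinarith [norm_nonneg (ν + k + 1), (Nat.cast_nonneg k : (0 : ℝ) ≤ k)]
  nlinarith [mul_nonneg (norm_nonneg (besselCoeff ν (k + 1))) (norm_nonneg (w ^ k))]

theorem hasSum_besselEntire (ν w : ℂ) :
    HasSum (fun k : ℕ => besselCoeff ν k * w ^ k) (besselEntire ν w) :=
  (summable_norm_besselCoeff ν w).of_norm.hasSum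

theorem hasDerivAt_besselEntire (ν w : ℂ) :
    HasDerivAt (besselEntire ν) (-besselEntire (ν + 1) w) w := by
  set R : ℝ := ‖w‖ + 1
  have hu := summable_norm_besselCoeff ν (R : ℂ)
  have hw : w ∈ Metric.ball (0 : ℂ) R := by simp [R]
  have hf : ∀ k : ℕ, DifferentiableOn ℂ (fun w : ℂ => besselCoeff ν k * w ^ k)
      (Metric.ball (0 : ℂ) R) := fun k => by fun_prop
  have hle : ∀ (k : ℕ) (z : ℂ), z ∈ Metric.ball (0 : ℂ) R →
      ‖besselCoeff ν k * z ^ k‖ ≤ ‖besselCoeff ν k * (R : ℂ) ^ k‖ := fun k z hz => by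
    rw [mem_ball_zero_iff] at hz
    have hR : ‖(R : ℂ)‖ = R := by
      rw [Complex.norm_real, Real.norm_of_nonneg]; positivity
    rw [norm_mul, norm_mul, norm_pow, norm_pow, hR]
    gcongr
  have hd := Complex.differentiableOn_tsum_of_summable_norm hu hf Metric.isOpen_ball hle
  have hs := Complex.hasSum_deriv_of_summable_norm hu hf Metric.isOpen_ball hle hw
  have hdw := (hd.differentiableAt (Metric.isOpen_ball.mem_nhds hw)).hasDerivAt
  have key : HasSum (fun k : ℕ => deriv (fun w : ℂ => besselCoeff ν k * w ^ k) w)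
      (-besselEntire (ν + 1) w) := by
    rw [← hasSum_nat_add_iff' 1]
    have h := (hasSum_besselEntire (ν + 1) w).neg
    convert h using 1
    · ext k
      rw [deriv_const_mul _ (by fun_prop), deriv_pow_field]
      have := succ_mul_besselCoeff_succ ν k
      push_cast
      linear_combination w ^ k * this
    · simp
  have heq := hs.unique key
  rw [← heq]
  exact hdw

theorem self_mul_besselEntire (ν w : ℂ) :
    ν * besselEntire ν w = besselEntire (ν - 1) w + w * besselEntire (ν + 1) w := by
  have h1 := (hasSum_besselEntire ν w).mul_left ν
  have h2 := hasSum_besselEntire (ν - 1) w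
  have h3 := (hasSum_besselEntire (ν + 1) w).mul_left w
  have h4 := h1.sub h2
  rw [← hasSum_nat_add_iff' 1] at h4
  have h5 : ∀ k : ℕ, ν * (besselCoeff ν (k + 1) * w ^ (k + 1)) -
      besselCoeff (ν - 1) (k + 1) * w ^ (k + 1) = w * (besselCoeff (ν + 1) k * w ^ k) := fun k => by
    have e1 := besselCoeff_sub_one ν (k + 1)
    have e2 := succ_mul_besselCoeff_succ ν k
    push_cast at e1
    linear_combination -w ^ (k + 1) * e1 - w ^ (k + 1) * e2
  simp only [h5] at h4
  have h6 := h4.unique h3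
  have e0 := besselCoeff_sub_one ν 0
  simp only [Finset.range_one, Finset.sum_singleton, pow_zero, mul_one, Nat.cast_zero,
    add_zero] at h6 e0
  linear_combination h6 - e0

/-- Both sides satisfy the same two-step recursion in `n`. -/
theorem besselEntire_neg_nat (n : ℕ) (w : ℂ) :
    besselEntire (-n) w = (-w) ^ n * besselEntire n w := by
  induction n using Nat.twoStepInduction with
  | zero => simp
  | one =>
    have h := self_mul_besselEntire 0 w
    simp only [zero_mul, zero_sub, zero_add] at h
    simp only [Nat.cast_one, pow_one]
    linear_combination -h
  | more n h0 h1 =>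
    have ha := self_mul_besselEntire (-((n + 1 : ℕ) : ℂ)) w
    have hb := self_mul_besselEntire ((n + 1 : ℕ) : ℂ) w
    push_cast at ha hb h0 h1 ⊢
    rw [show -((n : ℂ) + 1) - 1 = -(n + 2) by ring, show -((n : ℂ) + 1) + 1 = -n by ring,
      h0, h1] at ha
    rw [show (n : ℂ) + 1 - 1 = n by ring, show (n : ℂ) + 1 + 1 = n + 2 by ring] at hb
    linear_combination -ha - (-w) ^ (n + 1) * hb

/-! ### Contiguous relations of the Bessel functions -/

theorem besselJ_natCast (n : ℕ) (z : ℂ) :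
    besselJ n z = (z / 2) ^ n * besselEntire n ((z / 2) ^ 2) := by
  rw [besselJ_eq, Complex.cpow_natCast]

theorem besselJ_neg_natCast (n : ℕ) (z : ℂ) :
    besselJ (-n) z = (-1) ^ n * besselJ n z := by
  rw [besselJ_eq, besselEntire_neg_nat, besselJ_natCast, Complex.cpow_neg, Complex.cpow_natCast]
  rcases eq_or_ne z 0 with rfl | hz
  · rcases n.eq_zero_or_pos with rfl | hn
    · simp
    · simp [hn.ne']
  · have hz2 : (z / 2) ^ n ≠ 0 := pow_ne_zero _ (div_ne_zero hz two_ne_zero)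
    rw [neg_pow ((z / 2) ^ 2), inv_mul_eq_iff_eq_mul₀ hz2, ← pow_mul, mul_comm 2 n, pow_mul]
    ring

theorem hasDerivAt_half_sq (z : ℂ) : HasDerivAt (fun z : ℂ => (z / 2) ^ 2) (z / 2) z := by
  refine (((hasDerivAt_id z).div_const 2).pow 2).congr_deriv ?_
  simp only [id, Nat.cast_ofNat]
  ring

theorem hasDerivAt_besselEntire_half_sq (ν z : ℂ) :
    HasDerivAt (fun z : ℂ => besselEntire ν ((z / 2) ^ 2))
      (-besselEntire (ν + 1) ((z / 2) ^ 2) * (z / 2)) z :=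
  HasDerivAt.comp (h₂ := besselEntire ν) z (hasDerivAt_besselEntire ν ((z / 2) ^ 2))
    (hasDerivAt_half_sq z)

theorem hasDerivAt_besselJ_natCast (n : ℕ) (z : ℂ) :
    HasDerivAt (besselJ n) ((besselJ (n - 1) z - besselJ (n + 1) z) / 2) z := by
  have hfun : besselJ n = fun z => (z / 2) ^ n * besselEntire n ((z / 2) ^ 2) :=
    funext fun z => besselJ_natCast n z
  have hd := (((hasDerivAt_id z).div_const 2).pow n).mul (hasDerivAt_besselEntire_half_sq n z)
  rw [hfun]
  refine hd.congr_deriv ?_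
  have hp := besselJ_natCast (n + 1) z
  push_cast at hp
  rw [hp]
  -- at order `0` the power rule gives nothing, and `J_{-1} = -J_1` takes its place
  rcases n with _ | n
  · have hm := besselJ_neg_natCast 1 z
    have h1 := besselJ_natCast 1 z
    push_cast at hm h1
    simp only [Nat.cast_zero, zero_sub, hm, h1]
    simp
    ring
  · have hm := besselJ_natCast n z
    have hr := self_mul_besselEntire (n + 1) ((z / 2) ^ 2)
    rw [add_sub_cancel_right] at hr
    push_cast
    rw [add_sub_cancel_right, hm]
    simp only [id, Pi.pow_apply]
    linear_combination (z / 2) ^ n / 2 * hr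

theorem self_mul_besselJ_natCast (n : ℕ) (z : ℂ) :
    2 * n * besselJ n z = z * (besselJ (n - 1) z + besselJ (n + 1) z) := by
  have hp := besselJ_natCast (n + 1) z
  push_cast at hp
  rw [hp]
  rcases n with _ | n
  · have hm := besselJ_neg_natCast 1 z
    have h1 := besselJ_natCast 1 z
    push_cast at hm h1
    simp only [Nat.cast_zero, zero_sub, hm, h1]
    simp
  · have hm := besselJ_natCast n z
    have hr := self_mul_besselEntire (n + 1) ((z / 2) ^ 2)
    rw [add_sub_cancel_right] at hr
    rw [besselJ_natCast]
    push_cast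
    rw [add_sub_cancel_right, hm]
    linear_combination 2 * (z / 2) ^ (n + 1) * hr

theorem besselJ_neg_intCast (m : ℤ) (z : ℂ) : besselJ (-m) z = (-1) ^ m * besselJ m z := by
  obtain ⟨n, rfl | rfl⟩ := m.eq_nat_or_neg
  · simpa using besselJ_neg_natCast n z
  · have h := besselJ_neg_natCast n z
    push_cast
    rw [neg_neg, h, zpow_neg, zpow_natCast, ← mul_assoc, inv_mul_cancel₀ (by simp), one_mul]

/-- The domain on which the contiguous relations hold: all `z` if the order is an integer, the slit
plane otherwise. -/
def BesselDomain (ν z : ℂ) : Prop := (∃ m : ℤ, ν = m) ∨ z ∈ Complex.slitPlane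

theorem BesselDomain.add_intCast {ν z : ℂ} (h : BesselDomain ν z) (k : ℤ) :
    BesselDomain (ν + k) z := by
  rcases h with ⟨m, rfl⟩ | h
  · exact Or.inl ⟨m + k, by push_cast; rfl⟩
  · exact Or.inr h

theorem hasDerivAt_besselJ {ν z : ℂ} (h : BesselDomain ν z) :
    HasDerivAt (besselJ ν) ((besselJ (ν - 1) z - besselJ (ν + 1) z) / 2) z := by
  rcases h with ⟨m, rfl⟩ | hz
  · obtain ⟨n, rfl | rfl⟩ := m.eq_nat_or_neg
    · exact_mod_cast hasDerivAt_besselJ_natCast n z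
    · have hd := (hasDerivAt_besselJ_natCast n z).const_mul ((-1 : ℂ) ^ n)
      have e0 : besselJ ((-(n : ℤ) : ℤ) : ℂ) = fun z => (-1 : ℂ) ^ n * besselJ n z := by
        ext z
        simpa using besselJ_neg_natCast n z
      have e1 := besselJ_neg_intCast (n + 1) z
      have e2 := besselJ_neg_intCast (n - 1) z
      rw [zpow_add₀ (by norm_num), zpow_natCast] at e1
      rw [zpow_sub₀ (by norm_num), zpow_natCast] at e2
      push_cast at e0 e1 e2 ⊢
      rw [e0]
      refine hd.congr_deriv ?_
      rw [show -(n : ℂ) - 1 = -(n + 1) by ring, show -(n : ℂ) + 1 = -(n - 1) by ring, e1, e2]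
      norm_num
      ring
  · have hz0 : z / 2 ≠ 0 := div_ne_zero (Complex.slitPlane_ne_zero hz) two_ne_zero
    have hz2 : z / 2 ∈ Complex.slitPlane := by
      rw [Complex.mem_slitPlane_iff] at hz ⊢
      rcases hz with hz | hz
      · left; simpa using hz
      · right; simpa using hz
    have hfun : besselJ ν = fun z => (z / 2) ^ ν * besselEntire ν ((z / 2) ^ 2) :=
      funext fun z => besselJ_eq ν z
    have hd := (((hasDerivAt_id z).div_const 2).cpow_const (c := ν) hz2).mul
      (hasDerivAt_besselEntire_half_sq ν z)
    have hr := self_mul_besselEntire ν ((z / 2) ^ 2)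
    have e1 : (z / 2) ^ ν = (z / 2) ^ (ν - 1) * (z / 2) := by
      rw [Complex.cpow_sub _ _ hz0, Complex.cpow_one, div_mul_cancel₀ _ hz0]
    have e2 : (z / 2) ^ (ν + 1) = (z / 2) ^ (ν - 1) * (z / 2) * (z / 2) := by
      rw [Complex.cpow_add _ _ hz0, Complex.cpow_one, e1]
    rw [besselJ_eq (ν - 1), besselJ_eq (ν + 1), e2, hfun]
    refine hd.congr_deriv ?_
    simp only [id]
    rw [e1]
    linear_combination (z / 2) ^ (ν - 1) / 2 * hr

theorem self_mul_besselJ {ν z : ℂ} (h : BesselDomain ν z) :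
    2 * ν * besselJ ν z = z * (besselJ (ν - 1) z + besselJ (ν + 1) z) := by
  rcases h with ⟨m, rfl⟩ | hz
  · obtain ⟨n, rfl | rfl⟩ := m.eq_nat_or_neg
    · exact_mod_cast self_mul_besselJ_natCast n z
    · have hn := self_mul_besselJ_natCast n z
      have e0 := besselJ_neg_natCast n z
      have e1 := besselJ_neg_intCast (n + 1) z
      have e2 := besselJ_neg_intCast (n - 1) z
      rw [zpow_add₀ (by norm_num), zpow_natCast] at e1
      rw [zpow_sub₀ (by norm_num), zpow_natCast] at e2
      push_cast at e0 e1 e2 ⊢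
      rw [show -(n : ℂ) - 1 = -(n + 1) by ring, show -(n : ℂ) + 1 = -(n - 1) by ring, e0, e1, e2]
      norm_num
      linear_combination -(-1) ^ n * hn
  · have hz0 : z / 2 ≠ 0 := div_ne_zero (Complex.slitPlane_ne_zero hz) two_ne_zero
    have hr := self_mul_besselEntire ν ((z / 2) ^ 2)
    have e1 : (z / 2) ^ ν = (z / 2) ^ (ν - 1) * (z / 2) := by
      rw [Complex.cpow_sub _ _ hz0, Complex.cpow_one, div_mul_cancel₀ _ hz0]
    have e2 : (z / 2) ^ (ν + 1) = (z / 2) ^ (ν - 1) * (z / 2) * (z / 2) := by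
      rw [Complex.cpow_add _ _ hz0, Complex.cpow_one, e1]
    rw [besselJ_eq (ν - 1), besselJ_eq (ν + 1), besselJ_eq ν, e2, e1]
    linear_combination 2 * (z / 2) ^ (ν - 1) * (z / 2) * hr

theorem hasDerivAt_besselJ_mul_besselJ {ν a b z : ℂ} (hab : a * b ≠ 0)
    (ha : BesselDomain ν (a * z)) (hb : BesselDomain ν (b * z)) :
    HasDerivAt (fun w : ℂ => 2 * ν * (a * b)⁻¹ * besselJ ν (a * w) * besselJ ν (b * w))
      (z * (besselJ (ν - 1) (a * z) * besselJ (ν - 1) (b * z) -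
        besselJ (ν + 1) (a * z) * besselJ (ν + 1) (b * z))) z := by
  have hda := (hasDerivAt_besselJ ha).comp z ((hasDerivAt_id z).const_mul a)
  have hdb := (hasDerivAt_besselJ hb).comp z ((hasDerivAt_id z).const_mul b)
  refine ((hda.const_mul (2 * ν * (a * b)⁻¹)).mul hdb).congr_deriv ?_
  have ra := self_mul_besselJ ha
  have rb := self_mul_besselJ hb
  obtain ⟨ha0, hb0⟩ := mul_ne_zero_iff.mp hab
  simp only [Function.comp, mul_one]
  field_simp
  linear_combination
    (besselJ (ν - 1) (a * z) - besselJ (ν + 1) (a * z)) * a / 2 * rb +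
    (besselJ (ν - 1) (b * z) - besselJ (ν + 1) (b * z)) * b / 2 * ra

/-- The derivatives of the single terms telescope. -/
theorem hasDerivAt_sum_besselJ_mul_besselJ {ν a b z : ℂ} {n n' : ℤ} (hab : a * b ≠ 0)
    (hn : n ≤ n') (ha : BesselDomain ν (a * z)) (hb : BesselDomain ν (b * z)) :
    HasDerivAt
      (fun w : ℂ => ∑ k ∈ Finset.Icc n n',
        2 * (ν + 2 * k) * (a * b)⁻¹ * besselJ (ν + 2 * k) (a * w) * besselJ (ν + 2 * k) (b * w))
      (z * (besselJ (ν + 2 * n - 1) (a * z) * besselJ (ν + 2 * n - 1) (b * z) -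
        besselJ (ν + 2 * n' + 1) (a * z) * besselJ (ν + 2 * n' + 1) (b * z))) z := by
  have hterm : ∀ k : ℤ, HasDerivAt (fun w : ℂ => 2 * (ν + 2 * k) * (a * b)⁻¹ *
      besselJ (ν + 2 * k) (a * w) * besselJ (ν + 2 * k) (b * w))
      (z * (besselJ (ν + 2 * k - 1) (a * z) * besselJ (ν + 2 * k - 1) (b * z) -
        besselJ (ν + 2 * k + 1) (a * z) * besselJ (ν + 2 * k + 1) (b * z))) z := fun k => by
    have ha' := ha.add_intCast (2 * k)
    have hb' := hb.add_intCast (2 * k)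
    push_cast at ha' hb'
    exact hasDerivAt_besselJ_mul_besselJ hab ha' hb'
  induction n', hn using Int.leInduction with
  | base => simpa using hterm n
  | succ m hm ih =>
    have hIcc : Finset.Icc n (m + 1) = insert (m + 1) (Finset.Icc n m) := by
      ext x
      simp only [Finset.mem_Icc, Finset.mem_insert]
      omega
    have hnot : m + 1 ∉ Finset.Icc n m := by simp
    simp only [hIcc, Finset.sum_insert hnot]
    refine ((hterm (m + 1)).add ih).congr_deriv ?_
    push_cast
    rw [show ν + 2 * ((m : ℂ) + 1) - 1 = ν + 2 * m + 1 by ring]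
    ring

/-! ### Half-integer orders: the kernels `φ_m(x) = √x J_{m-1/2}(x)` -/

/-- The even entire function `S_m` with `√x J_{m-1/2}(x) = x ^ m * S_m(x)` for `x > 0`. -/
noncomputable def redBessel (m : ℕ) (x : ℝ) : ℝ :=
  √2 / 2 ^ m * (besselEntire (m - 1 / 2) ((x / 2) ^ 2)).re

/-- The function `x ↦ √x J_{m-1/2}(x)`, continued analytically from `x > 0` to all real `x`. -/
noncomputable def hankelFun (m : ℕ) (x : ℝ) : ℝ := x ^ m * redBessel m x

/-- The real continuation of `s ↦ (2ν)^(1/2) s^(-1/2) J_ν(s)`, `ν = m + 1/2`. -/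
noncomputable def besselRealFun (m : ℕ) (x : ℝ) : ℝ := √(2 * m + 1) * (x ^ m * redBessel (m + 1) x)

theorem besselEntire_ofReal (ν w : ℝ) :
    besselEntire ν w = ((besselEntire ν w).re : ℂ) := by
  have h : besselEntire ν w =
      ((∑' k : ℕ, (-1 : ℝ) ^ k * ((k ! : ℝ) * Real.Gamma (ν + k + 1))⁻¹ * w ^ k : ℝ) : ℂ) := by
    rw [Complex.ofReal_tsum, besselEntire]
    refine tsum_congr fun k => ?_
    rw [besselCoeff]
    push_cast [← Complex.Gamma_ofReal]
    rfl
  rw [h, Complex.ofReal_re]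

theorem ofReal_redBessel (m : ℕ) (x : ℝ) :
    (redBessel m x : ℂ) = (√2 : ℝ) / 2 ^ m * besselEntire (m - 1 / 2) ((x / 2) ^ 2) := by
  have h := besselEntire_ofReal (m - 1 / 2) ((x / 2) ^ 2)
  push_cast at h
  rw [redBessel]
  push_cast
  rw [← h]

theorem hasDerivAt_redBessel (m : ℕ) (x : ℝ) :
    HasDerivAt (redBessel m) (-x * redBessel (m + 1) x) x := by
  have h := (hasDerivAt_besselEntire_half_sq (m - 1 / 2) (x : ℂ)).real_of_complex
  have h2 := h.const_mul (√2 / 2 ^ m)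
  refine h2.congr_deriv ?_
  rw [show (m : ℂ) - 1 / 2 + 1 = ((m + 1 : ℕ) : ℂ) - 1 / 2 by push_cast; ring,
    show ((x : ℂ) / 2) = ((x / 2 : ℝ) : ℂ) by push_cast; rfl, Complex.re_mul_ofReal, Complex.neg_re,
    redBessel, pow_succ]
  push_cast
  ring_nf

theorem redBessel_recurrence (m : ℕ) (x : ℝ) :
    (2 * m + 1) * redBessel (m + 1) x = redBessel m x + x ^ 2 * redBessel (m + 2) x := by
  have h := self_mul_besselEntire (m + 1 / 2) (((x : ℂ) / 2) ^ 2)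
  rw [← Complex.ofReal_inj]
  push_cast
  rw [ofReal_redBessel, ofReal_redBessel, ofReal_redBessel]
  push_cast
  rw [show (m : ℂ) + 1 - 1 / 2 = m + 1 / 2 by ring,
    show (m : ℂ) + 2 - 1 / 2 = m + 1 / 2 + 1 by ring,
    show (m : ℂ) - 1 / 2 = m + 1 / 2 - 1 by ring, pow_add _ m 1, pow_add _ m 2]
  linear_combination (√2 : ℂ) / 2 ^ m * h

/-- At order `-1/2` the series is the cosine series, by the duplication formula for `Γ`. -/
theorem redBessel_zero (x : ℝ) : redBessel 0 x = √(2 / Real.pi) * Real.cos x := by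
  have hcos := Complex.hasSum_cos (x : ℂ)
  have hE : besselEntire (-(1 / 2)) (((x : ℂ) / 2) ^ 2) = (√Real.pi : ℂ)⁻¹ * Complex.cos x := by
    have hk : ∀ k : ℕ, besselCoeff (-(1 / 2)) k * (((x : ℂ) / 2) ^ 2) ^ k =
        (√Real.pi : ℂ)⁻¹ * ((-1) ^ k * (x : ℂ) ^ (2 * k) / ((2 * k)! : ℂ)) := fun k => by
      have hdup := Complex.Gamma_mul_Gamma_add_half (k + 1 / 2)
      rw [show (k : ℂ) + 1 / 2 + 1 / 2 = k + 1 by ring, Complex.Gamma_nat_eq_factorial,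
        show 2 * ((k : ℂ) + 1 / 2) = ((2 * k : ℕ) : ℂ) + 1 by push_cast; ring,
        Complex.Gamma_nat_eq_factorial,
        show 1 - (((2 * k : ℕ) : ℂ) + 1) = -((2 * k : ℕ) : ℂ) by ring, Complex.cpow_neg,
        Complex.cpow_natCast] at hdup
      rw [besselCoeff, show -(1 / 2 : ℂ) + k + 1 = k + 1 / 2 by ring, mul_comm (k ! : ℂ), hdup]
      have hpi : (√Real.pi : ℂ) ≠ 0 := by
        exact_mod_cast (Real.sqrt_pos.mpr Real.pi_pos).ne'
      have hf : ((2 * k)! : ℂ) ≠ 0 := by exact_mod_cast (2 * k).factorial_ne_zero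
      field_simp
      rw [pow_mul, ← mul_pow, pow_mul]
      field_simp
    have hsum := hasSum_besselEntire (-(1 / 2)) (((x : ℂ) / 2) ^ 2)
    simp only [hk] at hsum
    exact hsum.unique (hcos.mul_left _)
  rw [← Complex.ofReal_inj, ofReal_redBessel, Nat.cast_zero, zero_sub, hE,
    Real.sqrt_div zero_le_two]
  push_cast
  ring

theorem continuous_redBessel (m : ℕ) : Continuous (redBessel m) :=
  continuous_iff_continuousAt.mpr fun x => (hasDerivAt_redBessel m x).continuousAt

theorem continuous_hankelFun (m : ℕ) : Continuous (hankelFun m) :=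
  (continuous_pow m).mul (continuous_redBessel m)

theorem continuous_besselRealFun (m : ℕ) : Continuous (besselRealFun m) :=
  continuous_const.mul ((continuous_pow m).mul (continuous_redBessel (m + 1)))

theorem hankelFun_zero (x : ℝ) : hankelFun 0 x = √(2 / Real.pi) * Real.cos x := by
  rw [hankelFun, redBessel_zero, pow_zero, one_mul]

theorem hankelFun_one (x : ℝ) : hankelFun 1 x = √(2 / Real.pi) * Real.sin x := by
  have h1 := hasDerivAt_redBessel 0 x
  have h2 : HasDerivAt (redBessel 0) (√(2 / Real.pi) * -Real.sin x) x := by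
    rw [funext redBessel_zero]
    exact (Real.hasDerivAt_cos x).const_mul _
  have h := h1.unique h2
  rw [hankelFun, pow_one]
  linear_combination -h

/-- The function `t ↦ t ^ (2m+1) * S_{m+1}(tx)` has the derivative `t ^ (2m) * S_m(tx)`. -/
theorem redBessel_eq_integral (m : ℕ) (x : ℝ) :
    redBessel (m + 1) x = ∫ t in (0 : ℝ)..1, t ^ (2 * m) * redBessel m (t * x) := by
  have hd : ∀ t ∈ uIcc (0 : ℝ) 1, HasDerivAt
      (fun t : ℝ => t ^ (2 * m + 1) * redBessel (m + 1) (t * x))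
      (t ^ (2 * m) * redBessel m (t * x)) t := fun t _ => by
    have h1 := HasDerivAt.comp (h₂ := redBessel (m + 1)) t
      (hasDerivAt_redBessel (m + 1) (t * x)) ((hasDerivAt_id t).mul_const x)
    refine ((hasDerivAt_pow (2 * m + 1) t).mul h1).congr_deriv ?_
    have hr := redBessel_recurrence m (t * x)
    simp only [Function.comp, id, add_tsub_cancel_right]
    push_cast
    linear_combination t ^ (2 * m) * hr
  have hc : Continuous fun t : ℝ => t ^ (2 * m) * redBessel m (t * x) :=
    (continuous_pow _).mul ((continuous_redBessel m).comp (continuous_id.mul continuous_const))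
  rw [intervalIntegral.integral_eq_sub_of_hasDerivAt hd (hc.intervalIntegrable 0 1)]
  simp

theorem abs_redBessel_le (m : ℕ) (x : ℝ) : |redBessel m x| ≤ 1 / m ! := by
  induction m generalizing x with
  | zero =>
    rw [redBessel_zero, abs_mul, Nat.factorial_zero, Nat.cast_one, div_one,
      abs_of_nonneg (Real.sqrt_nonneg _)]
    have h1 : √(2 / Real.pi) ≤ 1 := by
      rw [Real.sqrt_le_one]
      rw [div_le_one Real.pi_pos]
      exact Real.two_le_pi
    exact mul_le_one₀ h1 (abs_nonneg _) (Real.abs_cos_le_one x)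
  | succ m ih =>
    rw [redBessel_eq_integral, ← Real.norm_eq_abs]
    have hle : ‖∫ t in (0 : ℝ)..1, t ^ (2 * m) * redBessel m (t * x)‖ ≤
        ∫ t in (0 : ℝ)..1, t ^ (2 * m) * (1 / m !) := by
      refine intervalIntegral.norm_integral_le_of_norm_le zero_le_one ?_ ?_
      · refine Eventually.of_forall fun t ht => ?_
        rw [norm_mul, Real.norm_of_nonneg (pow_nonneg ht.1.le _), Real.norm_eq_abs]
        exact mul_le_mul_of_nonneg_left (ih (t * x)) (pow_nonneg ht.1.le _)
      · exact ((continuous_pow _).mul continuous_const).intervalIntegrable 0 1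
    refine hle.trans ?_
    rw [intervalIntegral.integral_mul_const, integral_pow, Nat.factorial_succ]
    push_cast
    simp only [one_pow, ne_eq, Nat.add_eq_zero_iff, one_ne_zero, and_false, not_false_eq_true,
      zero_pow, sub_zero]
    rw [div_mul_div_comm, one_mul]
    gcongr
    linarith [(Nat.cast_nonneg m : (0 : ℝ) ≤ m)]

theorem abs_hankelFun_le (m : ℕ) (x : ℝ) : |hankelFun m x| ≤ |x| ^ m / m ! := by
  rw [hankelFun, abs_mul, abs_pow, ← mul_one_div]
  exact mul_le_mul_of_nonneg_left (abs_redBessel_le m x) (by positivity)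

theorem hankelFun_recurrence (m : ℕ) (x : ℝ) :
    (2 * m + 1) * hankelFun (m + 1) x = x * (hankelFun m x + hankelFun (m + 2) x) := by
  simp only [hankelFun]
  linear_combination x ^ (m + 1) * redBessel_recurrence m x

/-- The kernels are bounded: near `0` by the previous estimate, and away from `0` by the recurrence,
starting from the cosine and the sine. -/
theorem exists_abs_hankelFun_le (m : ℕ) : ∃ C : ℝ, ∀ x, |hankelFun m x| ≤ C := by
  have hpi : ∀ y : ℝ, |y| ≤ 1 → |√(2 / Real.pi) * y| ≤ √(2 / Real.pi) := fun y hy => by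
    rw [abs_mul, abs_of_nonneg (Real.sqrt_nonneg _)]
    exact mul_le_of_le_one_right (Real.sqrt_nonneg _) hy
  induction m using Nat.twoStepInduction with
  | zero => exact ⟨_, fun x => by rw [hankelFun_zero]; exact hpi _ (Real.abs_cos_le_one x)⟩
  | one => exact ⟨_, fun x => by rw [hankelFun_one]; exact hpi _ (Real.abs_sin_le_one x)⟩
  | more m h0 h1 =>
    obtain ⟨C0, h0⟩ := h0
    obtain ⟨C1, h1⟩ := h1
    have hC0 : 0 ≤ C0 := (abs_nonneg _).trans (h0 0)
    have hC1 : 0 ≤ C1 := (abs_nonneg _).trans (h1 0)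
    refine ⟨1 + ((2 * m + 1) * C1 + C0), fun x => ?_⟩
    have hm : (0 : ℝ) ≤ 2 * m + 1 := by positivity
    rcases le_total |x| 1 with hx | hx
    · refine (abs_hankelFun_le (m + 2) x).trans ?_
      have : |x| ^ (m + 2) / ((m + 2)! : ℝ) ≤ 1 := by
        rw [div_le_one (by positivity)]
        exact (pow_le_one₀ (abs_nonneg x) hx).trans
          (by exact_mod_cast (m + 2).factorial_pos)
      nlinarith [mul_nonneg hm hC1]
    · have hr : x * hankelFun (m + 2) x =
          (2 * m + 1) * hankelFun (m + 1) x - x * hankelFun m x := by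
        linear_combination -hankelFun_recurrence m x
      have h2 : |x| * |hankelFun (m + 2) x| ≤ (2 * m + 1) * C1 + |x| * C0 := by
        rw [← abs_mul, hr]
        refine (abs_sub _ _).trans ?_
        rw [abs_mul, abs_mul, abs_of_nonneg hm]
        gcongr
        · exact h1 x
        · exact h0 x
      have h3 : |x| * |hankelFun (m + 2) x| ≤ |x| * ((2 * m + 1) * C1 + C0) := by
        nlinarith [mul_nonneg hm hC1]
      linarith [le_of_mul_le_mul_left h3 (by linarith)]

theorem mul_besselRealFun (m : ℕ) (x : ℝ) :
    x * besselRealFun m x = √(2 * m + 1) * hankelFun (m + 1) x := by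
  rw [besselRealFun, hankelFun]
  ring

theorem exists_abs_besselRealFun_le (m : ℕ) :
    ∃ C : ℝ, 0 ≤ C ∧ ∀ x, |besselRealFun m x| ≤ C ∧ |x| * |besselRealFun m x| ≤ C := by
  obtain ⟨C, hC⟩ := exists_abs_hankelFun_le (m + 1)
  have hC0 : 0 ≤ C := (abs_nonneg _).trans (hC 0)
  have hs := Real.sqrt_nonneg (2 * m + 1)
  have hx : ∀ x, |x| * |besselRealFun m x| ≤ √(2 * m + 1) * C := fun x => by
    rw [← abs_mul, mul_besselRealFun, abs_mul, abs_of_nonneg hs]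
    exact mul_le_mul_of_nonneg_left (hC x) hs
  refine ⟨√(2 * m + 1) * C + √(2 * m + 1), by positivity, fun x => ⟨?_, ?_⟩⟩
  · rcases le_total |x| 1 with h | h
    · have h1 : |besselRealFun m x| ≤ √(2 * m + 1) := by
        rw [besselRealFun, abs_mul, abs_of_nonneg hs, abs_mul, abs_pow]
        refine mul_le_of_le_one_right hs (mul_le_one₀ (pow_le_one₀ (abs_nonneg x) h) (abs_nonneg _)
          ((abs_redBessel_le (m + 1) x).trans ?_))
        rw [div_le_one (by positivity)]
        exact_mod_cast (m + 1).factorial_pos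
      nlinarith [mul_nonneg hs hC0]
    · nlinarith [hx x, abs_nonneg (besselRealFun m x)]
  · linarith [hx x]

/-- The integrated contiguous relation: the kernels of two Hankel cutoffs whose orders differ by
`2` differ by a kernel of rank one. -/
theorem integral_hankelFun_mul_sub (m : ℕ) (x y A : ℝ) :
    ∫ t in (0 : ℝ)..A, (hankelFun m (x * t) * hankelFun m (y * t) -
      hankelFun (m + 2) (x * t) * hankelFun (m + 2) (y * t)) =
      A * (besselRealFun m (x * A) * besselRealFun m (y * A)) := by
  have hf : ∀ z t : ℝ, HasDerivAt (fun t : ℝ => besselRealFun m (z * t))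
      (√(2 * m + 1) * (m * (z * t) ^ (m - 1) * redBessel (m + 1) (z * t) +
        (z * t) ^ m * (-(z * t) * redBessel (m + 2) (z * t))) * z) t := fun z t => by
    have h1 : HasDerivAt (besselRealFun m) (√(2 * m + 1) *
        (m * (z * t) ^ (m - 1) * redBessel (m + 1) (z * t) +
        (z * t) ^ m * (-(z * t) * redBessel (m + 2) (z * t)))) (z * t) :=
      ((hasDerivAt_pow m (z * t)).mul (hasDerivAt_redBessel (m + 1) (z * t))).const_mul _
    refine (HasDerivAt.comp t h1 ((hasDerivAt_id t).const_mul z)).congr_deriv ?_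
    rw [mul_one]
  have hpow : ∀ z : ℝ, (m : ℝ) * z ^ (m - 1) * z = m * z ^ m := fun z => by
    rcases m with _ | m
    · simp
    · rw [add_tsub_cancel_right, pow_succ]; ring
  have hs : √(2 * (m : ℝ) + 1) * √(2 * m + 1) = 2 * m + 1 := Real.mul_self_sqrt (by positivity)
  have hd : ∀ t ∈ uIcc (0 : ℝ) A, HasDerivAt
      (fun t : ℝ => t * (besselRealFun m (x * t) * besselRealFun m (y * t)))
      (hankelFun m (x * t) * hankelFun m (y * t) -
        hankelFun (m + 2) (x * t) * hankelFun (m + 2) (y * t)) t := fun t _ => by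
    refine ((hasDerivAt_id t).mul ((hf x t).mul (hf y t))).congr_deriv ?_
    -- the product rule, with `(2m+1) S_{m+1}` replaced by `S_m + x² S_{m+2}` in both factors
    have hx := hpow (x * t)
    have hy := hpow (y * t)
    have rx := redBessel_recurrence m (x * t)
    have ry := redBessel_recurrence m (y * t)
    simp only [id, Pi.mul_apply, besselRealFun, hankelFun]
    linear_combination
      √(2 * (m : ℝ) + 1) ^ 2 * redBessel (m + 1) (x * t) * redBessel (m + 1) (y * t) *
          ((y * t) ^ m * hx + (x * t) ^ m * hy) +
        (x * t) ^ m * (y * t) ^ m * ((1 + 2 * m) * redBessel (m + 1) (x * t) *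
          redBessel (m + 1) (y * t) - (x * t) ^ 2 * redBessel (m + 2) (x * t) *
          redBessel (m + 1) (y * t) - (y * t) ^ 2 * redBessel (m + 1) (x * t) *
          redBessel (m + 2) (y * t)) * hs +
        (x * t) ^ m * (y * t) ^ m * ((2 * m + 1) * redBessel (m + 1) (y * t) -
          (y * t) ^ 2 * redBessel (m + 2) (y * t)) * rx +
        (x * t) ^ m * (y * t) ^ m * redBessel m (x * t) * ry
  have hc : Continuous fun t : ℝ => hankelFun m (x * t) * hankelFun m (y * t) -
      hankelFun (m + 2) (x * t) * hankelFun (m + 2) (y * t) := by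
    have := continuous_hankelFun m
    have := continuous_hankelFun (m + 2)
    fun_prop
  rw [intervalIntegral.integral_eq_sub_of_hasDerivAt hd (hc.intervalIntegrable 0 A), zero_mul,
    sub_zero]

/-! ### Truncated integral transforms with kernel `κ(sy)` -/

/-- A bounded continuous function `κ`, to be used in a kernel `(s, y) ↦ κ (s * y)`. -/
structure IsBddKernel (κ : ℝ → ℝ) : Prop where
  continuous : Continuous κ
  bounded : ∃ C : ℝ, ∀ x, |κ x| ≤ C

/-- The truncated transform `s ↦ ∫₀^A κ(s y) g(y) dy`. -/
noncomputable def truncTransform (κ : ℝ → ℝ) (A : ℝ) (g : ℝ → ℂ) (s : ℝ) : ℂ :=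
  ∫ y in Ioc (0 : ℝ) A, (κ (s * y) : ℂ) * g y

theorem isBddKernel_hankelFun (m : ℕ) : IsBddKernel (hankelFun m) :=
  ⟨continuous_hankelFun m, exists_abs_hankelFun_le m⟩

theorem posMeasure_restrict_Ioc (A : ℝ) :
    posMeasure.restrict (Ioc 0 A) = volume.restrict (Ioc (0 : ℝ) A) := by
  rw [Measure.restrict_restrict measurableSet_Ioc, inter_eq_left.mpr fun x hx => hx.1]

theorem L2Pos.integrableOn_Ioc (g : L2Pos) (A : ℝ) : IntegrableOn g (Ioc (0 : ℝ) A) := by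
  have h := (Lp.memLp g).restrict (Ioc (0 : ℝ) A)
  rw [posMeasure_restrict_Ioc] at h
  exact h.integrable one_le_two

theorem integrableOn_star {g : ℝ → ℂ} {s : Set ℝ} (hg : IntegrableOn g s) :
    IntegrableOn (fun y => star (g y)) s :=
  (starL' ℝ : ℂ ≃L[ℝ] ℂ).toContinuousLinearMap.integrable_comp hg

theorem star_truncTransform (κ : ℝ → ℝ) (A : ℝ) (g : ℝ → ℂ) (s : ℝ) :
    star (truncTransform κ A g s) = truncTransform κ A (fun y => star (g y)) s := by
  rw [truncTransform, truncTransform]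
  refine (integral_conj (𝕜 := ℂ)).symm.trans (integral_congr_ae (Eventually.of_forall fun y => ?_))
  simp

namespace IsBddKernel

theorem continuous_ofReal {κ : ℝ → ℝ} (hκ : IsBddKernel κ) : Continuous fun x => (κ x : ℂ) :=
  Complex.continuous_ofReal.comp hκ.continuous

theorem integrableOn_mul {κ : ℝ → ℝ} (hκ : IsBddKernel κ)
    {g : ℝ → ℂ} {s : Set ℝ} (hg : IntegrableOn g s) (x : ℝ) :
    IntegrableOn (fun y => (κ (x * y) : ℂ) * g y) s := by
  obtain ⟨C, hC⟩ := hκ.bounded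
  refine hg.bdd_mul (c := C) ?_ (Eventually.of_forall fun y => ?_)
  · exact (hκ.continuous_ofReal.comp (continuous_const.mul continuous_id)).aestronglyMeasurable
  · rw [Complex.norm_real]
    exact hC _

theorem integrableOn_Ioc {κ : ℝ → ℝ} (hκ : IsBddKernel κ)
    (x A : ℝ) : IntegrableOn (fun t => (κ (x * t) : ℂ)) (Ioc 0 A) :=
  (hκ.continuous_ofReal.comp (continuous_const.mul continuous_id)).integrableOn_Ioc

theorem continuous_truncTransform {κ : ℝ → ℝ} (hκ : IsBddKernel κ)
    {g : ℝ → ℂ} {A : ℝ} (hg : IntegrableOn g (Ioc 0 A)) :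
    Continuous (truncTransform κ A g) := by
  obtain ⟨C, hC⟩ := hκ.bounded
  refine continuous_of_dominated (bound := fun y => C * ‖g y‖)
    (fun s => (hκ.integrableOn_mul hg s).aestronglyMeasurable)
    (fun s => Eventually.of_forall fun y => ?_) (hg.norm.const_mul C)
    (Eventually.of_forall fun y => ?_)
  · rw [norm_mul, Complex.norm_real]
    exact mul_le_mul_of_nonneg_right (hC _) (norm_nonneg _)
  · exact (hκ.continuous_ofReal.comp (continuous_id.mul continuous_const)).mul continuous_const

theorem exists_norm_truncTransform_le {κ : ℝ → ℝ} (hκ : IsBddKernel κ)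
    {g : ℝ → ℂ} {A : ℝ} (hg : IntegrableOn g (Ioc 0 A)) :
    ∃ D : ℝ, ∀ s, ‖truncTransform κ A g s‖ ≤ D := by
  obtain ⟨C, hC⟩ := hκ.bounded
  refine ⟨∫ y in Ioc (0 : ℝ) A, C * ‖g y‖, fun s =>
    norm_integral_le_of_norm_le (hg.norm.const_mul C)
    (Eventually.of_forall fun y => ?_)⟩
  rw [norm_mul, Complex.norm_real]
  exact mul_le_mul_of_nonneg_right (hC _) (norm_nonneg _)

theorem integrableOn_mul_truncTransform {κ : ℝ → ℝ} (hκ : IsBddKernel κ)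
    {f g : ℝ → ℂ} {A B : ℝ} (hf : IntegrableOn f (Ioc 0 B))
    (hg : IntegrableOn g (Ioc 0 A)) :
    IntegrableOn (fun s => f s * truncTransform κ A g s) (Ioc 0 B) := by
  obtain ⟨D, hD⟩ := hκ.exists_norm_truncTransform_le hg
  exact hf.mul_bdd (c := D) (hκ.continuous_truncTransform hg).aestronglyMeasurable
    (Eventually.of_forall hD)

theorem integrableOn_truncTransform {κ : ℝ → ℝ} (hκ : IsBddKernel κ)
    {g : ℝ → ℂ} {A : ℝ} (hg : IntegrableOn g (Ioc 0 A)) (B : ℝ) :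
    IntegrableOn (truncTransform κ A g) (Ioc 0 B) :=
  (hκ.continuous_truncTransform hg).integrableOn_Ioc

/-- Fubini's theorem: the truncated transforms are symmetric. -/
theorem integral_mul_truncTransform {κ : ℝ → ℝ} (hκ : IsBddKernel κ)
    {f g : ℝ → ℂ} {A B : ℝ} (hf : IntegrableOn f (Ioc 0 A))
    (hg : IntegrableOn g (Ioc 0 B)) :
    ∫ s in Ioc (0 : ℝ) A, f s * truncTransform κ B g s =
      ∫ y in Ioc (0 : ℝ) B, g y * truncTransform κ A f y := by
  obtain ⟨C, hC⟩ := hκ.bounded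
  have hint : Integrable (fun p : ℝ × ℝ => (κ (p.1 * p.2) : ℂ) * (f p.1 * g p.2))
      ((volume.restrict (Ioc 0 A)).prod (volume.restrict (Ioc 0 B))) := by
    refine (hf.mul_prod hg).bdd_mul (c := C) ?_ (Eventually.of_forall fun p => ?_)
    · exact (hκ.continuous_ofReal.comp (continuous_fst.mul continuous_snd)).aestronglyMeasurable
    · rw [Complex.norm_real]
      exact hC _
  calc ∫ s in Ioc (0 : ℝ) A, f s * truncTransform κ B g s
      = ∫ s in Ioc (0 : ℝ) A, ∫ y in Ioc (0 : ℝ) B, (κ (s * y) : ℂ) * (f s * g y) := by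
        refine integral_congr_ae (Eventually.of_forall fun s => ?_)
        simp only [truncTransform]
        rw [← integral_const_mul]
        exact integral_congr_ae (Eventually.of_forall fun y => by ring)
    _ = ∫ y in Ioc (0 : ℝ) B, ∫ s in Ioc (0 : ℝ) A, (κ (s * y) : ℂ) * (f s * g y) :=
        integral_integral_swap hint
    _ = ∫ y in Ioc (0 : ℝ) B, g y * truncTransform κ A f y := by
        refine integral_congr_ae (Eventually.of_forall fun y => ?_)
        simp only [truncTransform]
        rw [← integral_const_mul]
        exact integral_congr_ae (Eventually.of_forall fun s => by
          simp only [mul_comm s y]; ring)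

theorem truncTransform_truncTransform {κ : ℝ → ℝ} (hκ : IsBddKernel κ)
    {g : ℝ → ℂ} {B : ℝ} (hg : IntegrableOn g (Ioc 0 B))
    (A x : ℝ) :
    truncTransform κ A (truncTransform κ B g) x =
      ∫ y in Ioc (0 : ℝ) B, g y * truncTransform κ A (fun t => (κ (x * t) : ℂ)) y :=
  hκ.integral_mul_truncTransform (hκ.integrableOn_Ioc x A) hg

end IsBddKernel

/-- The integrated contiguous relation, written with truncated transforms of the kernels. -/
theorem truncTransform_hankelFun_sub (m : ℕ) {A : ℝ} (hA : 0 ≤ A) (x y : ℝ) :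
    truncTransform (hankelFun m) A (fun t => (hankelFun m (x * t) : ℂ)) y -
      truncTransform (hankelFun (m + 2)) A (fun t => (hankelFun (m + 2) (x * t) : ℂ)) y =
      ((A * (besselRealFun m (x * A) * besselRealFun m (y * A)) : ℝ) : ℂ) := by
  rw [← integral_hankelFun_mul_sub, intervalIntegral.integral_of_le hA, ← integral_complex_ofReal,
    truncTransform, truncTransform, ← integral_sub]
  · refine integral_congr_ae (Eventually.of_forall fun t => ?_)
    push_cast
    ring
  · exact (isBddKernel_hankelFun m).integrableOn_mul
      ((isBddKernel_hankelFun m).integrableOn_Ioc x A) y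
  · exact (isBddKernel_hankelFun (m + 2)).integrableOn_mul
      ((isBddKernel_hankelFun (m + 2)).integrableOn_Ioc x A) y

/-- Truncating between two Hankel transforms whose orders differ by `2` gives operators that differ
by an operator of rank one. -/
theorem truncTransform_truncTransform_hankelFun_sub (m : ℕ) {A B : ℝ} (hA : 0 ≤ A) {g : ℝ → ℂ}
    (hg : IntegrableOn g (Ioc 0 B)) (x : ℝ) :
    truncTransform (hankelFun m) A (truncTransform (hankelFun m) B g) x -
      truncTransform (hankelFun (m + 2)) A (truncTransform (hankelFun (m + 2)) B g) x =
      A * besselRealFun m (x * A) * ∫ y in Ioc (0 : ℝ) B, (besselRealFun m (y * A) : ℂ) * g y := by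
  have h0 := isBddKernel_hankelFun m
  have h2 := isBddKernel_hankelFun (m + 2)
  rw [h0.truncTransform_truncTransform hg, h2.truncTransform_truncTransform hg, ← integral_sub
    (h0.integrableOn_mul_truncTransform hg (h0.integrableOn_Ioc x A))
    (h2.integrableOn_mul_truncTransform hg (h2.integrableOn_Ioc x A)), ← integral_const_mul]
  refine integral_congr_ae (Eventually.of_forall fun y => ?_)
  simp only
  rw [← mul_sub, truncTransform_hankelFun_sub m hA]
  push_cast
  ring

theorem IsBddKernel.integral_norm_sq_truncTransform {κ : ℝ → ℝ} (hκ : IsBddKernel κ) (A : ℝ) {B : ℝ}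
    {g : ℝ → ℂ} (hg : IntegrableOn g (Ioc 0 B)) :
    ((∫ s in Ioc (0 : ℝ) A, ‖truncTransform κ B g s‖ ^ 2 : ℝ) : ℂ) =
      ∫ y in Ioc (0 : ℝ) B, star (g y) * truncTransform κ A (truncTransform κ B g) y := by
  rw [← hκ.integral_mul_truncTransform (hκ.integrableOn_truncTransform hg A) (integrableOn_star hg),
    ← integral_complex_ofReal]
  refine integral_congr_ae (Eventually.of_forall fun s => ?_)
  simp only
  rw [← star_truncTransform]
  push_cast
  exact (Complex.mul_conj' _).symm

/-- The energy on `]0, A]` that is lost when the order is raised by `2`. -/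
theorem integral_norm_sq_truncTransform_hankelFun_sub (m : ℕ) {A B : ℝ} (hA : 0 ≤ A) {g : ℝ → ℂ}
    (hg : IntegrableOn g (Ioc 0 B)) :
    (∫ s in Ioc (0 : ℝ) A, ‖truncTransform (hankelFun m) B g s‖ ^ 2) -
      (∫ s in Ioc (0 : ℝ) A, ‖truncTransform (hankelFun (m + 2)) B g s‖ ^ 2) =
      A * ‖∫ y in Ioc (0 : ℝ) B, (besselRealFun m (y * A) : ℂ) * g y‖ ^ 2 := by
  have h0 := isBddKernel_hankelFun m
  have h2 := isBddKernel_hankelFun (m + 2)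
  set J : ℂ := ∫ y in Ioc (0 : ℝ) B, (besselRealFun m (y * A) : ℂ) * g y with hJ
  have hstar : star J = ∫ y in Ioc (0 : ℝ) B, (besselRealFun m (y * A) : ℂ) * star (g y) := by
    refine (integral_conj (𝕜 := ℂ)).symm.trans
      (integral_congr_ae (Eventually.of_forall fun y => ?_))
    simp
  rw [← Complex.ofReal_inj, Complex.ofReal_sub, h0.integral_norm_sq_truncTransform A hg,
    h2.integral_norm_sq_truncTransform A hg, ← integral_sub
    (h0.integrableOn_mul_truncTransform (integrableOn_star hg)
      (h0.integrableOn_truncTransform hg A))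
    (h2.integrableOn_mul_truncTransform (integrableOn_star hg)
      (h2.integrableOn_truncTransform hg A))]
  calc _ = ∫ y in Ioc (0 : ℝ) B, A * J * ((besselRealFun m (y * A) : ℂ) * star (g y)) := by
        refine integral_congr_ae (Eventually.of_forall fun y => ?_)
        simp only
        rw [← mul_sub, truncTransform_truncTransform_hankelFun_sub m hA hg, ← hJ]
        ring
    _ = _ := by
        rw [integral_const_mul, ← hstar]
        push_cast
        rw [← Complex.mul_conj', mul_assoc]
        rfl

/-! ### Plancherel's theorem for the cosine and sine transforms -/

open FourierTransform in
/-- On `L¹ ∩ L²` the Fourier integral represents the Fourier transform on `L²`. -/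
theorem fourier_toLp_ae_eq {f : ℝ → ℂ} (h1 : Integrable f) (h2 : MemLp f 2) :
    (𝓕 (h2.toLp f) : Lp ℂ 2 (volume : Measure ℝ)) =ᵐ[volume] 𝓕 f := by
  have hcont : Continuous (𝓕 f) :=
    VectorFourier.fourierIntegral_continuous Real.continuous_fourierChar
      (innerSL ℝ).continuous₂ h1
  refine ae_eq_of_integral_contDiff_smul_eq
    ((Lp.memLp _).locallyIntegrable one_le_two) hcont.locallyIntegrable fun g hg hgs => ?_
  have hg₁ : HasCompactSupport (Complex.ofRealCLM ∘ g) := hgs.comp_left rfl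
  have hg₂ := Complex.ofRealCLM.contDiff.comp hg
  set G : SchwartzMap ℝ ℂ := hg₁.toSchwartzMap hg₂ with hG
  have hGg : ∀ x, G x = g x := fun x => rfl
  have e1 : ∫ x, g x • (𝓕 (h2.toLp f) : Lp ℂ 2 (volume : Measure ℝ)) x =
      Lp.toTemperedDistribution (𝓕 (h2.toLp f)) G := by
    rw [Lp.toTemperedDistribution_apply]
    rfl
  have e2 : ∫ x, (𝓕 G) x • f x = ∫ x, G x • 𝓕 f x := by
    rw [SchwartzMap.fourier_coe]
    have h := VectorFourier.integral_fourierIntegral_smul_eq_flip (L := innerₗ ℝ) (μ := volume)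
      (ν := volume) Real.continuous_fourierChar (innerSL ℝ).continuous₂ G.integrable h1
    rw [flip_innerₗ] at h
    exact h
  rw [e1, ← Lp.fourier_toTemperedDistribution_eq, TemperedDistribution.fourier_apply,
    Lp.toTemperedDistribution_apply]
  calc _ = ∫ x, (𝓕 G) x • f x := by
        refine integral_congr_ae ?_
        filter_upwards [h2.coeFn_toLp] with x hx
        rw [hx]
    _ = _ := by rw [e2]; rfl

open FourierTransform in
theorem eLpNorm_fourier_of_integrable {f : ℝ → ℂ} (h1 : Integrable f) (h2 : MemLp f 2) :
    eLpNorm (𝓕 f) 2 volume = eLpNorm f 2 volume := by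
  rw [← eLpNorm_congr_ae (fourier_toLp_ae_eq h1 h2), ← eLpNorm_congr_ae h2.coeFn_toLp,
    ← Lp.enorm_def, ← Lp.enorm_def, enorm_eq_nnnorm, enorm_eq_nnnorm]
  congr 1
  exact NNReal.eq (Lp.norm_fourier_eq _)

theorem integral_norm_sq_eq_eLpNorm {α : Type*} [MeasurableSpace α] {μ : Measure α} {f : α → ℂ}
    (hf : MemLp f 2 μ) : ∫ x, ‖f x‖ ^ 2 ∂μ = (eLpNorm f 2 μ).toReal ^ 2 := by
  have h0 : 0 ≤ ∫ x, ‖f x‖ ^ (2 : ℝ) ∂μ := integral_nonneg fun x => by positivity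
  rw [hf.eLpNorm_eq_integral_rpow_norm two_ne_zero ENNReal.ofNat_ne_top, ENNReal.toReal_ofNat,
    ENNReal.toReal_ofReal (Real.rpow_nonneg h0 _), ← Real.rpow_natCast, ← Real.rpow_mul h0]
  simp

open FourierTransform in
/-- Plancherel's theorem for the even (`ε = 1`) and the odd (`ε = -1`) continuation of a function
on the half-line. The function `τ` is the cosine or the sine. -/
theorem truncTransform_plancherel {τ : ℝ → ℝ} {ε c : ℂ} {σ : ℝ} (hτ : IsBddKernel τ)
    (hexp : ∀ x : ℝ, Complex.exp (-x * Complex.I) + ε * Complex.exp (x * Complex.I) = c * τ x)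
    (hε : ‖ε‖ = 1) (hc : ‖c‖ = 2) (hσ : |σ| = 1) (hpar : ∀ x, τ (-x) = σ * τ x)
    (g : L2Pos) (B : ℝ) :
    MemLp (truncTransform (fun x => √(2 / Real.pi) * τ x) B g) 2 posMeasure ∧
    ∫ s in Ioi (0 : ℝ), ‖truncTransform (fun x => √(2 / Real.pi) * τ x) B g s‖ ^ 2 =
      ∫ y in Ioc (0 : ℝ) B, ‖g y‖ ^ 2 := by
  set h : ℝ → ℂ := truncTransform (fun x => √(2 / Real.pi) * τ x) B g with hh
  set g0 : ℝ → ℂ := (Ioc (0 : ℝ) B).indicator g with hg0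
  have hg01 : Integrable g0 :=
    (integrable_indicator_iff measurableSet_Ioc).mpr (g.integrableOn_Ioc B)
  have hg02 : MemLp g0 2 := by
    rw [hg0, memLp_indicator_iff_restrict measurableSet_Ioc, ← posMeasure_restrict_Ioc]
    exact (Lp.memLp g).restrict _
  set G : ℝ → ℂ := fun y => g0 y + ε * g0 (-y) with hG
  have hG1 : Integrable G := hg01.add (hg01.comp_neg.const_mul ε)
  have hG2 : MemLp G 2 := hg02.add
    ((hg02.comp_measurePreserving (Measure.measurePreserving_neg volume)).const_mul ε)
  have hFcont : Continuous (𝓕 G) :=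
    VectorFourier.fourierIntegral_continuous Real.continuous_fourierChar
      (innerSL ℝ).continuous₂ hG1
  have hF2 : MemLp (𝓕 G) 2 := ⟨hFcont.aestronglyMeasurable, by
    rw [eLpNorm_fourier_of_integrable hG1 hG2]; exact hG2.2⟩
  have hFG : ∫ w, ‖𝓕 G w‖ ^ 2 = ∫ y, ‖G y‖ ^ 2 := by
    rw [integral_norm_sq_eq_eLpNorm hF2, integral_norm_sq_eq_eLpNorm hG2,
      eLpNorm_fourier_of_integrable hG1 hG2]
  have hexpint : ∀ (w : ℝ) {u : ℝ → ℂ}, Integrable u →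
      Integrable fun v => Complex.exp (((-2 * Real.pi * v * w : ℝ) : ℂ) * Complex.I) * u v :=
    fun w u hu => hu.bdd_mul (c := 1) (by fun_prop)
      (Eventually.of_forall fun v => (Complex.norm_exp_ofReal_mul_I _).le)
  -- the Fourier integral of the even or odd continuation is a cosine or sine integral
  have hF : ∀ w, 𝓕 G w =
      c * ∫ y in Ioc (0 : ℝ) B, (τ (2 * Real.pi * w * y) : ℂ) * g y := fun w => by
    have hneg : ∫ v, Complex.exp (((-2 * Real.pi * v * w : ℝ) : ℂ) * Complex.I) * (ε * g0 (-v)) =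
        ∫ v, Complex.exp (((2 * Real.pi * v * w : ℝ) : ℂ) * Complex.I) * (ε * g0 v) := by
      rw [← integral_neg_eq_self]
      simp
    have hint2 : Integrable fun v =>
        Complex.exp (((2 * Real.pi * v * w : ℝ) : ℂ) * Complex.I) * (ε * g0 v) := by
      simpa using hexpint (-w) (hg01.const_mul ε)
    rw [Real.fourier_real_eq_integral_exp_smul]
    simp only [smul_eq_mul, hG, mul_add]
    rw [integral_add (hexpint w hg01) (hexpint w (hg01.comp_neg.const_mul ε)), hneg,
      ← integral_add (hexpint w hg01) hint2, ← integral_const_mul,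
      ← integral_indicator measurableSet_Ioc]
    refine integral_congr_ae (Eventually.of_forall fun v => ?_)
    have he := hexp (2 * Real.pi * w * v)
    simp only [hg0, indicator]
    split_ifs
    · rw [← mul_assoc c, ← he]
      push_cast
      rw [show -2 * (Real.pi : ℂ) * v * w = -(2 * Real.pi * w * v) by ring,
        show 2 * (Real.pi : ℂ) * v * w = 2 * Real.pi * w * v by ring]
      ring
    · simp
  have hk : ∀ s, h s = √(2 / Real.pi) * ∫ y in Ioc (0 : ℝ) B, (τ (s * y) : ℂ) * g y := fun s => by
    rw [hh, truncTransform, ← integral_const_mul]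
    refine integral_congr_ae (Eventually.of_forall fun y => ?_)
    push_cast
    ring
  have hFh : ∀ w, ‖𝓕 G w‖ ^ 2 = 2 * Real.pi * ‖h (2 * Real.pi * w)‖ ^ 2 := fun w => by
    rw [hF, hk, norm_mul, norm_mul, mul_pow, mul_pow, hc, Complex.norm_real, Real.norm_eq_abs,
      sq_abs, Real.sq_sqrt (by positivity)]
    have := Real.pi_ne_zero
    field_simp
  have hpi : 2 * Real.pi ≠ 0 := by positivity
  have hint : Integrable fun s => ‖h s‖ ^ 2 := by
    have h1 := ((memLp_two_iff_integrable_sq_norm hF2.1).mp hF2).const_mul (2 * Real.pi)⁻¹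
    simp only [hFh, inv_mul_cancel_left₀ hpi] at h1
    exact (integrable_comp_mul_left_iff (fun s => ‖h s‖ ^ 2) hpi).mp h1
  have hhc : Continuous h := IsBddKernel.continuous_truncTransform
    ⟨continuous_const.mul hτ.continuous, by
      obtain ⟨C, hC⟩ := hτ.bounded
      refine ⟨|√(2 / Real.pi)| * C, fun x => ?_⟩
      rw [Pi.mul_apply, abs_mul]
      exact mul_le_mul_of_nonneg_left (hC x) (abs_nonneg _)⟩ (g.integrableOn_Ioc B)
  refine ⟨((memLp_two_iff_integrable_sq_norm hhc.aestronglyMeasurable).mpr hint).restrict _, ?_⟩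
  have heven : ∀ s, ‖h (-s)‖ ^ 2 = ‖h s‖ ^ 2 := fun s => by
    have : h (-s) = σ * h s := by
      rw [hk, hk, mul_left_comm, ← integral_const_mul (σ : ℂ)]
      congr 1
      refine integral_congr_ae (Eventually.of_forall fun y => ?_)
      simp only [neg_mul, hpar]
      push_cast
      ring
    rw [this, norm_mul, Complex.norm_real, Real.norm_eq_abs, hσ, one_mul]
  have hI1 : ∫ s, ‖h s‖ ^ 2 = 2 * ∫ s in Ioi (0 : ℝ), ‖h s‖ ^ 2 := by
    rw [← integral_comp_abs (f := fun s => ‖h s‖ ^ 2)]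
    refine integral_congr_ae (Eventually.of_forall fun s => ?_)
    rcases abs_choice s with hs | hs <;> simp only [hs, heven]
  have hI2 : ∫ w, ‖𝓕 G w‖ ^ 2 = ∫ s, ‖h s‖ ^ 2 := by
    simp only [hFh]
    rw [integral_const_mul, Measure.integral_comp_mul_left (fun s => ‖h s‖ ^ 2), abs_inv,
      abs_of_pos (by positivity), smul_eq_mul, mul_inv_cancel_left₀ hpi]
  have hg02' : Integrable fun y => ‖g0 y‖ ^ 2 := (memLp_two_iff_integrable_sq_norm hg02.1).mp hg02
  have hI3 : ∫ y, ‖G y‖ ^ 2 = 2 * ∫ y in Ioc (0 : ℝ) B, ‖g y‖ ^ 2 := by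
    -- the supports of the two summands of `G` are disjoint
    have hsplit : ∀ y, ‖G y‖ ^ 2 = ‖g0 y‖ ^ 2 + ‖g0 (-y)‖ ^ 2 := fun y => by
      rcases le_or_gt y 0 with hy | hy
      · have : g0 y = 0 := indicator_of_notMem (fun hm => hy.not_gt hm.1) _
        simp [hG, this, hε]
      · have : g0 (-y) = 0 := indicator_of_notMem (fun hm => by linarith [hm.1]) _
        simp [hG, this]
    have hind : ∫ y, ‖g0 y‖ ^ 2 = ∫ y in Ioc (0 : ℝ) B, ‖g y‖ ^ 2 := by
      rw [← integral_indicator measurableSet_Ioc]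
      refine integral_congr_ae (Eventually.of_forall fun y => ?_)
      simp only [hg0, indicator]
      split_ifs <;> simp
    simp only [hsplit]
    rw [integral_add hg02' hg02'.comp_neg, integral_neg_eq_self (fun y => ‖g0 y‖ ^ 2), hind,
      two_mul]
  linarith

theorem truncTransform_cos_plancherel (g : L2Pos) (B : ℝ) :
    MemLp (truncTransform (hankelFun 0) B g) 2 posMeasure ∧
    ∫ s in Ioi (0 : ℝ), ‖truncTransform (hankelFun 0) B g s‖ ^ 2 =
      ∫ y in Ioc (0 : ℝ) B, ‖g y‖ ^ 2 := by
  rw [funext hankelFun_zero]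
  refine truncTransform_plancherel (τ := Real.cos) (ε := 1) (c := 2) (σ := 1)
    ⟨Real.continuous_cos, 1, Real.abs_cos_le_one⟩ (fun x => ?_) (by simp) (by simp) (by simp)
    (fun x => by rw [Real.cos_neg, one_mul]) g B
  push_cast
  rw [Complex.two_cos, one_mul, add_comm]

theorem truncTransform_sin_plancherel (g : L2Pos) (B : ℝ) :
    MemLp (truncTransform (hankelFun 1) B g) 2 posMeasure ∧
    ∫ s in Ioi (0 : ℝ), ‖truncTransform (hankelFun 1) B g s‖ ^ 2 =
      ∫ y in Ioc (0 : ℝ) B, ‖g y‖ ^ 2 := by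
  rw [funext hankelFun_one]
  refine truncTransform_plancherel (τ := Real.sin) (ε := -1) (c := -2 * Complex.I) (σ := -1)
    ⟨Real.continuous_sin, 1, Real.abs_sin_le_one⟩ (fun x => ?_) (by simp) (by simp) (by simp)
    (fun x => by rw [Real.sin_neg, neg_one_mul]) g B
  push_cast
  have h := Complex.two_sin (x : ℂ)
  linear_combination Complex.I * h + (Complex.exp (-x * Complex.I) -
    Complex.exp (x * Complex.I)) * Complex.I_sq

/-! ### Restriction of `L²` functions to measurable sets -/

/-- The class in `L²(ℝ₊)` of the function that agrees with `g` on `s` and vanishes off `s`. -/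
noncomputable def restrictVec {s : Set ℝ} (hs : MeasurableSet s) (g : L2Pos) : L2Pos :=
  ((Lp.memLp g).indicator hs).toLp (s.indicator g)

theorem coeFn_restrictVec {s : Set ℝ} (hs : MeasurableSet s) (g : L2Pos) :
    restrictVec hs g =ᵐ[posMeasure] s.indicator g :=
  MemLp.coeFn_toLp _

theorem restrictVec_restrictVec {s t : Set ℝ} (hs : MeasurableSet s) (ht : MeasurableSet t)
    (hst : t ⊆ s) (g : L2Pos) : restrictVec hs (restrictVec ht g) = restrictVec ht g := by
  classical
  refine Lp.ext ?_
  filter_upwards [coeFn_restrictVec hs (restrictVec ht g), coeFn_restrictVec ht g] with x h1 h2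
  rw [h1, indicator_apply, h2, indicator_apply]
  by_cases hx : x ∈ t
  · simp [hx, hst hx]
  · simp [hx]

theorem L2Pos.norm_sq_eq (g : L2Pos) : ‖g‖ ^ 2 = ∫ x in Ioi (0 : ℝ), ‖g x‖ ^ 2 := by
  rw [integral_norm_sq_eq_eLpNorm (Lp.memLp g), Lp.norm_def]

theorem norm_sq_toLp {f : ℝ → ℂ} (hf : MemLp f 2 posMeasure) :
    ‖hf.toLp f‖ ^ 2 = ∫ x in Ioi (0 : ℝ), ‖f x‖ ^ 2 := by
  rw [integral_norm_sq_eq_eLpNorm hf, Lp.norm_toLp]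

theorem norm_sq_restrictVec {s : Set ℝ} (hs : MeasurableSet s) (g : L2Pos) :
    ‖restrictVec hs g‖ ^ 2 = ∫ x in Ioi (0 : ℝ) ∩ s, ‖g x‖ ^ 2 := by
  classical
  rw [L2Pos.norm_sq_eq, ← setIntegral_indicator hs]
  refine integral_congr_ae ?_
  filter_upwards [coeFn_restrictVec hs g] with x hx
  rw [hx, indicator_apply, indicator_apply]
  split_ifs <;> simp

theorem L2Pos.integrable_norm_sq (g : L2Pos) : IntegrableOn (fun x => ‖g x‖ ^ 2) (Ioi (0 : ℝ)) :=
  (memLp_two_iff_integrable_sq_norm (Lp.memLp g).1).mp (Lp.memLp g)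

theorem tendsto_restrictVec {ι : Type*} {l : Filter ι} [l.IsCountablyGenerated] {s : ι → Set ℝ}
    (hs : AECover posMeasure l s) (g : L2Pos) :
    Tendsto (fun i => restrictVec (hs.measurableSet i) g) l (𝓝 g) := by
  classical
  rw [tendsto_iff_norm_sub_tendsto_zero]
  have hsq : Tendsto (fun i => ‖restrictVec (hs.measurableSet i) g - g‖ ^ 2) l (𝓝 0) := by
    have heq : ∀ i, ‖restrictVec (hs.measurableSet i) g - g‖ ^ 2 =
        (∫ x in Ioi (0 : ℝ), ‖g x‖ ^ 2) - ∫ x in s i, ‖g x‖ ^ 2 ∂posMeasure := fun i => by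
      rw [L2Pos.norm_sq_eq, ← integral_indicator (hs.measurableSet i), ← integral_sub
        g.integrable_norm_sq (g.integrable_norm_sq.indicator (hs.measurableSet i))]
      refine integral_congr_ae ?_
      filter_upwards [coeFn_restrictVec (hs.measurableSet i) g,
        Lp.coeFn_sub (restrictVec (hs.measurableSet i) g) g] with x h1 h2
      rw [h2, Pi.sub_apply, h1, indicator_apply, indicator_apply]
      split_ifs <;> simp
    have ht := hs.integral_tendsto_of_countably_generated g.integrable_norm_sq
    have h := (tendsto_const_nhds (x := ∫ x in Ioi (0 : ℝ), ‖g x‖ ^ 2)).sub ht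
    rw [sub_self] at h
    exact h.congr fun i => (heq i).symm
  have := hsq.sqrt
  simpa [Real.sqrt_sq (norm_nonneg _)] using this

theorem aecover_Ioc_zero : AECover posMeasure atTop fun A : ℝ => Ioc 0 A where
  ae_eventually_mem := by
    filter_upwards [ae_restrict_mem measurableSet_Ioi] with x hx
    filter_upwards [eventually_ge_atTop x] with A hA
    exact ⟨hx, hA⟩
  measurableSet _ := measurableSet_Ioc

theorem aecover_Ioc_inv : AECover posMeasure atTop fun A : ℝ => Ioc A⁻¹ A where
  ae_eventually_mem := by
    filter_upwards [ae_restrict_mem measurableSet_Ioi] with x hx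
    have hx : (0 : ℝ) < x := hx
    filter_upwards [eventually_ge_atTop x, eventually_gt_atTop x⁻¹] with A hA hA'
    exact ⟨inv_lt_of_inv_lt₀ hx hA', hA⟩
  measurableSet _ := measurableSet_Ioc

/-- The restriction of `g` to `]0, A]`. -/
noncomputable def truncVec (A : ℝ) (g : L2Pos) : L2Pos :=
  restrictVec (measurableSet_Ioc (a := 0) (b := A)) g

theorem tendsto_truncVec (g : L2Pos) : Tendsto (fun A => truncVec A g) atTop (𝓝 g) :=
  tendsto_restrictVec aecover_Ioc_zero g

theorem norm_sq_truncVec (A : ℝ) (g : L2Pos) :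
    ‖truncVec A g‖ ^ 2 = ∫ x in Ioc (0 : ℝ) A, ‖g x‖ ^ 2 := by
  rw [truncVec, norm_sq_restrictVec, inter_eq_right.mpr fun x hx => hx.1]

theorem ae_Ioc_of_ae_posMeasure {p : ℝ → Prop} (h : ∀ᵐ x ∂posMeasure, p x) (A : ℝ) :
    ∀ᵐ x ∂volume.restrict (Ioc (0 : ℝ) A), p x :=
  ae_restrict_of_ae_restrict_of_subset (fun _ hx => hx.1) h

theorem truncTransform_congr {f g : ℝ → ℂ} (h : f =ᵐ[posMeasure] g) (κ : ℝ → ℝ) (A : ℝ) :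
    truncTransform κ A f = truncTransform κ A g := by
  ext s
  refine integral_congr_ae ?_
  filter_upwards [ae_Ioc_of_ae_posMeasure h A] with y hy
  rw [hy]

theorem truncTransform_truncVec (κ : ℝ → ℝ) {A B : ℝ} (hAB : A ≤ B) (g : L2Pos) :
    truncTransform κ B (truncVec A g) = truncTransform κ A g := by
  rw [truncVec, truncTransform_congr (coeFn_restrictVec _ g)]
  ext s
  rw [truncTransform, truncTransform, ← integral_indicator measurableSet_Ioc,
    ← integral_indicator measurableSet_Ioc]
  refine integral_congr_ae (Eventually.of_forall fun y => ?_)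
  by_cases hy : y ∈ Ioc 0 A
  · simp [indicator_of_mem hy, indicator_of_mem (Ioc_subset_Ioc_right hAB hy)]
  · rw [indicator_of_notMem hy]
    exact indicator_apply_eq_zero.mpr fun _ => by rw [indicator_of_notMem hy, mul_zero]

theorem IsBddKernel.truncTransform_add {κ : ℝ → ℝ} (hκ : IsBddKernel κ) (A : ℝ) (f g : L2Pos) :
    truncTransform κ A (f + g : L2Pos) = truncTransform κ A f + truncTransform κ A g := by
  rw [truncTransform_congr (Lp.coeFn_add f g)]
  ext s
  rw [Pi.add_apply, truncTransform, truncTransform, truncTransform, ← integral_add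
    (hκ.integrableOn_mul (f.integrableOn_Ioc A) s) (hκ.integrableOn_mul (g.integrableOn_Ioc A) s)]
  simp only [Pi.add_apply, mul_add]

theorem truncTransform_smul (κ : ℝ → ℝ) (A : ℝ) (c : ℂ) (g : L2Pos) :
    truncTransform κ A (c • g : L2Pos) = c • truncTransform κ A g := by
  rw [truncTransform_congr (Lp.coeFn_smul c g)]
  ext s
  rw [Pi.smul_apply, truncTransform, truncTransform, ← integral_smul]
  simp only [Pi.smul_apply, smul_eq_mul]
  exact integral_congr_ae (Eventually.of_forall fun y => by ring)

/-! ### Limits in the mean of the truncated transforms -/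

/-- The truncated transforms are bounded on `L²(ℝ₊)` with norm at most `1`. -/
def IsContractive (κ : ℝ → ℝ) : Prop :=
  ∀ (A : ℝ) (g : L2Pos), MemLp (truncTransform κ A g) 2 posMeasure ∧
    ∫ s in Ioi (0 : ℝ), ‖truncTransform κ A g s‖ ^ 2 ≤ ‖g‖ ^ 2

/-- `T` is the transformation with kernel `κ (s * y)`, in the sense of limits in the mean. -/
abbrev IsMeanTransform (κ : ℝ → ℝ) (T : L2Pos →L[ℂ] L2Pos) : Prop :=
  IsMeanIntegralTransform (fun s y => (κ (s * y) : ℂ)) T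

/-- The truncated transform as a bounded operator. -/
noncomputable def truncOperator {κ : ℝ → ℝ} (hκ : IsBddKernel κ) (hb : IsContractive κ) (A : ℝ) :
    L2Pos →L[ℂ] L2Pos :=
  LinearMap.mkContinuous
    { toFun := fun g => (hb A g).1.toLp
      map_add' := fun f g => by
        rw [← MemLp.toLp_add]
        exact MemLp.toLp_congr _ _ (Eventually.of_forall fun s => by
          rw [hκ.truncTransform_add])
      map_smul' := fun c g => by
        rw [RingHom.id_apply, ← MemLp.toLp_const_smul]
        exact MemLp.toLp_congr _ _ (Eventually.of_forall fun s => by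
          rw [truncTransform_smul]) }
    1 fun g => by
      rw [one_mul]
      refine (pow_le_pow_iff_left₀ (norm_nonneg _) (norm_nonneg _) two_ne_zero).mp ?_
      exact (norm_sq_toLp (hb A g).1).trans_le (hb A g).2

theorem truncOperator_apply {κ : ℝ → ℝ} (hκ : IsBddKernel κ) (hb : IsContractive κ) (A : ℝ)
    (g : L2Pos) : truncOperator hκ hb A g = (hb A g).1.toLp := rfl

theorem norm_truncOperator_apply_le {κ : ℝ → ℝ} (hκ : IsBddKernel κ) (hb : IsContractive κ) (A : ℝ)
    (g : L2Pos) : ‖truncOperator hκ hb A g‖ ≤ ‖g‖ := by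
  refine (pow_le_pow_iff_left₀ (norm_nonneg _) (norm_nonneg _) two_ne_zero).mp ?_
  exact (norm_sq_toLp (hb A g).1).trans_le (hb A g).2

/-- The truncations of `g` form a Cauchy net, hence so do their transforms; the limit is continuous
by the Banach-Steinhaus theorem. -/
theorem IsContractive.exists_isMeanTransform {κ : ℝ → ℝ} (hb : IsContractive κ)
    (hκ : IsBddKernel κ) : ∃ T : L2Pos →L[ℂ] L2Pos, IsMeanTransform κ T := by
  set T := truncOperator hκ hb
  have htr : ∀ {A B : ℝ}, A ≤ B → ∀ g, T B (truncVec A g) = T A g := fun {A B} hAB g =>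
    MemLp.toLp_congr (hb B _).1 (hb A g).1 (Eventually.of_forall fun s => by
      rw [truncTransform_truncVec κ hAB])
  have hcauchy : ∀ g, CauchySeq fun A => T A g := fun g => by
    rw [Metric.cauchySeq_iff']
    intro ε hε
    obtain ⟨N, hN⟩ := ((Metric.tendsto_nhds.mp (tendsto_truncVec g) ε hε)).exists
    refine ⟨N, fun B hB => ?_⟩
    rw [dist_eq_norm, ← htr hB, ← map_sub]
    refine (norm_truncOperator_apply_le hκ hb B _).trans_lt ?_
    rwa [dist_comm, dist_eq_norm] at hN
  choose L hL using fun g => cauchySeq_tendsto_of_complete (hcauchy g)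
  refine ⟨continuousLinearMapOfTendsto T (tendsto_pi_nhds.mpr hL), fun g => ?_⟩
  have h := tendsto_iff_norm_sub_tendsto_zero.mp (hL g)
  have h2 := ENNReal.tendsto_ofReal h
  rw [ENNReal.ofReal_zero] at h2
  refine h2.congr fun A => ?_
  rw [ofReal_norm, Lp.enorm_def]
  refine eLpNorm_congr_ae ?_
  filter_upwards [Lp.coeFn_sub (T A g) (L g), (hb A g).1.coeFn_toLp] with s h1 h3
  rw [h1, Pi.sub_apply, truncOperator_apply, h3]
  rfl

theorem IsMeanIntegralTransform.congr_kernel {k k' : ℝ → ℝ → ℂ} {T : L2Pos →L[ℂ] L2Pos}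
    (hT : IsMeanIntegralTransform k T) (h : ∀ s y : ℝ, 0 < s → 0 < y → k s y = k' s y) :
    IsMeanIntegralTransform k' T := fun g => by
  refine (hT g).congr fun A => eLpNorm_congr_ae ?_
  filter_upwards [ae_restrict_mem measurableSet_Ioi] with s hs
  congr 1
  exact setIntegral_congr_fun measurableSet_Ioc fun y hy => by simp only [h s y hs hy.1]

/-- Limits in the mean are unique. -/
theorem IsMeanIntegralTransform.unique {k : ℝ → ℝ → ℂ} {T T' : L2Pos →L[ℂ] L2Pos}
    (hk : ∀ (A : ℝ) (g : L2Pos), AEStronglyMeasurable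
      (fun s => ∫ y in Ioc (0 : ℝ) A, k s y * g y) posMeasure)
    (hT : IsMeanIntegralTransform k T) (hT' : IsMeanIntegralTransform k T') : T = T' := by
  ext1 g
  have h : Tendsto (fun A : ℝ => eLpNorm (T g - T' g : ℝ → ℂ) 2 posMeasure) atTop (𝓝 0) := by
    have hsum := (hT g).add (hT' g)
    rw [add_zero] at hsum
    refine tendsto_of_tendsto_of_tendsto_of_le_of_le tendsto_const_nhds hsum
      (fun A => zero_le) fun A => ?_
    rw [← eLpNorm_neg (fun s => (∫ y in Ioc (0 : ℝ) A, k s y * g y) - T g s)]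
    have h1 : (T g - T' g : ℝ → ℂ) = -(fun s => (∫ y in Ioc (0 : ℝ) A, k s y * g y) - T g s) +
        fun s => (∫ y in Ioc (0 : ℝ) A, k s y * g y) - T' g s := by
      ext s
      simp
    rw [h1]
    exact eLpNorm_add_le ((hk A g).sub (Lp.memLp _).1).neg ((hk A g).sub (Lp.memLp _).1) one_le_two
  have h0 := tendsto_nhds_unique tendsto_const_nhds h
  rw [eLpNorm_eq_zero_iff ((Lp.memLp _).1.sub (Lp.memLp _).1) two_ne_zero] at h0
  refine Lp.ext ?_
  filter_upwards [h0] with s hs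
  exact sub_eq_zero.mp hs

theorem IsMeanIntegralTransform.meanIntegralTransform_spec {k : ℝ → ℝ → ℂ} {T : L2Pos →L[ℂ] L2Pos}
    (hT : IsMeanIntegralTransform k T) : IsMeanIntegralTransform k (meanIntegralTransform k) := by
  have h : ∃ T, IsMeanIntegralTransform k T := ⟨T, hT⟩
  rw [meanIntegralTransform, dif_pos h]
  exact h.choose_spec

/-- For functions of bounded support the limit in the mean is reached by the truncated transforms,
so the transform is given by the integral. -/
theorem IsMeanTransform.apply_truncVec {κ : ℝ → ℝ} {T : L2Pos →L[ℂ] L2Pos}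
    (hT : IsMeanTransform κ T) (hκ : IsBddKernel κ) (A : ℝ) (g : L2Pos) :
    T (truncVec A g) =ᵐ[posMeasure] truncTransform κ A g := by
  have hev : ∀ᶠ B in atTop, eLpNorm (fun s => (∫ y in Ioc (0 : ℝ) B, (κ (s * y) : ℂ) *
      truncVec A g y) - T (truncVec A g) s) 2 posMeasure =
      eLpNorm (truncTransform κ A g - T (truncVec A g) : ℝ → ℂ) 2 posMeasure := by
    filter_upwards [eventually_ge_atTop A] with B hB
    rw [← truncTransform_truncVec κ hB]
    rfl
  have h0 := tendsto_nhds_unique (tendsto_const_nhds.congr' (hev.mono fun _ h => h.symm))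
    (hT (truncVec A g))
  rw [eLpNorm_eq_zero_iff ((hκ.continuous_truncTransform
    (g.integrableOn_Ioc A)).aestronglyMeasurable.sub (Lp.memLp _).1) two_ne_zero] at h0
  filter_upwards [h0] with s hs
  exact (sub_eq_zero.mp hs).symm

theorem inner_truncVec_right (f g : L2Pos) (A : ℝ) :
    inner ℂ f (truncVec A g) = ∫ y in Ioc (0 : ℝ) A, g y * star (f y) := by
  rw [L2.inner_def, ← posMeasure_restrict_Ioc, ← integral_indicator measurableSet_Ioc]
  refine integral_congr_ae ?_
  filter_upwards [coeFn_restrictVec (measurableSet_Ioc (a := 0) (b := A)) g] with y hy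
  rw [truncVec, hy, indicator_apply, indicator_apply]
  split_ifs
  · rfl
  · simp

/-- The kernel is real and symmetric, so the transform is self-adjoint. -/
theorem IsMeanTransform.inner_apply_left {κ : ℝ → ℝ} {T : L2Pos →L[ℂ] L2Pos}
    (hT : IsMeanTransform κ T) (hκ : IsBddKernel κ) (f g : L2Pos) :
    inner ℂ (T f) g = inner ℂ f (T g) := by
  have htrunc : ∀ A, inner ℂ (T (truncVec A f)) (truncVec A g) =
      inner ℂ (truncVec A f) (T (truncVec A g)) := fun A => by
    have h1 : inner ℂ (T (truncVec A f)) (truncVec A g) =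
        ∫ y in Ioc (0 : ℝ) A, g y * truncTransform κ A (fun y => star (f y)) y := by
      rw [inner_truncVec_right]
      refine integral_congr_ae ?_
      filter_upwards [ae_Ioc_of_ae_posMeasure (hT.apply_truncVec hκ A f) A] with y hy
      rw [hy, star_truncTransform]
    have h2 : inner ℂ (truncVec A f) (T (truncVec A g)) =
        ∫ y in Ioc (0 : ℝ) A, star (f y) * truncTransform κ A g y := by
      rw [← inner_conj_symm, inner_truncVec_right]
      refine (integral_conj (𝕜 := ℂ)).symm.trans (integral_congr_ae ?_)
      filter_upwards [ae_Ioc_of_ae_posMeasure (hT.apply_truncVec hκ A g) A] with y hy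
      rw [hy]
      simp
    rw [h1, h2, hκ.integral_mul_truncTransform (g.integrableOn_Ioc A)
      (integrableOn_star (f.integrableOn_Ioc A))]
  have hl : Tendsto (fun A => inner ℂ (T (truncVec A f)) (truncVec A g)) atTop
      (𝓝 (inner ℂ (T f) g)) :=
    ((T.continuous.tendsto f).comp (tendsto_truncVec f)).inner (tendsto_truncVec g)
  have hr : Tendsto (fun A => inner ℂ (truncVec A f) (T (truncVec A g))) atTop
      (𝓝 (inner ℂ f (T g))) :=
    (tendsto_truncVec f).inner ((T.continuous.tendsto g).comp (tendsto_truncVec g))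
  simp only [htrunc] at hl
  exact tendsto_nhds_unique hl hr

/-- A symmetric isometry is an involution. -/
theorem IsMeanTransform.apply_apply {κ : ℝ → ℝ} {T : L2Pos →L[ℂ] L2Pos}
    (hT : IsMeanTransform κ T) (hκ : IsBddKernel κ) (hiso : ∀ g, ‖T g‖ = ‖g‖) (g : L2Pos) :
    T (T g) = g := by
  refine ext_inner_right ℂ fun f => ?_
  rw [hT.inner_apply_left hκ]
  exact (LinearMap.norm_map_iff_inner_map_map T.toLinearMap).mp hiso g f

/-! ### The Hankel transforms of half-integer order are isometric -/

theorem IsMeanTransform.norm_sq_apply_truncVec {κ : ℝ → ℝ} {T : L2Pos →L[ℂ] L2Pos}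
    (hT : IsMeanTransform κ T) (hκ : IsBddKernel κ) (A : ℝ) (g : L2Pos) :
    ‖T (truncVec A g)‖ ^ 2 = ∫ s in Ioi (0 : ℝ), ‖truncTransform κ A g s‖ ^ 2 := by
  rw [L2Pos.norm_sq_eq]
  refine integral_congr_ae ?_
  filter_upwards [hT.apply_truncVec hκ A g] with s hs
  rw [hs]

theorem IsMeanTransform.memLp_truncTransform {κ : ℝ → ℝ} {T : L2Pos →L[ℂ] L2Pos}
    (hT : IsMeanTransform κ T) (hκ : IsBddKernel κ) (A : ℝ) (g : L2Pos) :
    MemLp (truncTransform κ A g) 2 posMeasure :=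
  (memLp_congr_ae (hT.apply_truncVec hκ A g)).mp (Lp.memLp _)

theorem IsMeanTransform.integrableOn_norm_sq_truncTransform {κ : ℝ → ℝ} {T : L2Pos →L[ℂ] L2Pos}
    (hT : IsMeanTransform κ T) (hκ : IsBddKernel κ) (A : ℝ) (g : L2Pos) :
    IntegrableOn (fun s => ‖truncTransform κ A g s‖ ^ 2) (Ioi 0) :=
  (memLp_two_iff_integrable_sq_norm (hT.memLp_truncTransform hκ A g).1).mp
    (hT.memLp_truncTransform hκ A g)

theorem norm_truncVec_le (A : ℝ) (g : L2Pos) : ‖truncVec A g‖ ≤ ‖g‖ := by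
  refine (pow_le_pow_iff_left₀ (norm_nonneg _) (norm_nonneg _) two_ne_zero).mp ?_
  rw [norm_sq_truncVec, L2Pos.norm_sq_eq]
  exact setIntegral_mono_set g.integrable_norm_sq (Eventually.of_forall fun x => by positivity)
    (Eventually.of_forall fun x hx => hx.1)

theorem norm_apply_eq_of_tendsto {ι : Type*} {l : Filter ι} [l.NeBot] (T : L2Pos →L[ℂ] L2Pos)
    {u : ι → L2Pos} {g : L2Pos} (hu : Tendsto u l (𝓝 g)) (h : ∀ᶠ i in l, ‖T (u i)‖ = ‖u i‖) :
    ‖T g‖ = ‖g‖ :=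
  tendsto_nhds_unique ((((T.continuous.tendsto g).comp hu).norm).congr' h) hu.norm

theorem exists_isometry_of_plancherel {κ : ℝ → ℝ} (hκ : IsBddKernel κ)
    (h : ∀ (g : L2Pos) (B : ℝ), MemLp (truncTransform κ B g) 2 posMeasure ∧
      ∫ s in Ioi (0 : ℝ), ‖truncTransform κ B g s‖ ^ 2 = ∫ y in Ioc (0 : ℝ) B, ‖g y‖ ^ 2) :
    ∃ T : L2Pos →L[ℂ] L2Pos, IsMeanTransform κ T ∧ ∀ g, ‖T g‖ = ‖g‖ := by
  have hb : IsContractive κ := fun A g => ⟨(h g A).1, by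
    rw [(h g A).2, ← norm_sq_truncVec]
    exact pow_le_pow_left₀ (norm_nonneg _) (norm_truncVec_le A g) 2⟩
  obtain ⟨T, hT⟩ := hb.exists_isMeanTransform hκ
  refine ⟨T, hT, fun g => norm_apply_eq_of_tendsto T (tendsto_truncVec g)
    (Eventually.of_forall fun A => ?_)⟩
  refine (pow_left_inj₀ (norm_nonneg _) (norm_nonneg _) two_ne_zero).mp ?_
  rw [hT.norm_sq_apply_truncVec hκ, (h g A).2, norm_sq_truncVec]

theorem integrableOn_norm_sq_Ioc {κ : ℝ → ℝ} (hκ : IsBddKernel κ) (A B : ℝ) (g : L2Pos) :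
    IntegrableOn (fun s => ‖truncTransform κ B g s‖ ^ 2) (Ioc 0 A) posMeasure := by
  rw [IntegrableOn, posMeasure_restrict_Ioc]
  exact ((hκ.continuous_truncTransform (g.integrableOn_Ioc B)).norm.pow 2).integrableOn_Ioc

/-- The energy lost when the order is raised by `2` is nonnegative. -/
theorem isContractive_hankelFun_add_two {m : ℕ} {T : L2Pos →L[ℂ] L2Pos}
    (hT : IsMeanTransform (hankelFun m) T) (hiso : ∀ g, ‖T g‖ = ‖g‖) :
    IsContractive (hankelFun (m + 2)) := fun B g => by
  have h0 := isBddKernel_hankelFun m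
  have h2 := isBddKernel_hankelFun (m + 2)
  have hle : ∀ A, 0 ≤ A →
      ∫ s in Ioc 0 A, ‖truncTransform (hankelFun (m + 2)) B g s‖ ^ 2 ∂posMeasure ≤ ‖g‖ ^ 2 :=
    fun A hA => by
    rw [posMeasure_restrict_Ioc]
    have hsub := integral_norm_sq_truncTransform_hankelFun_sub m hA (g.integrableOn_Ioc B)
    have hpos : 0 ≤ A * ‖∫ y in Ioc (0 : ℝ) B, (besselRealFun m (y * A) : ℂ) * g y‖ ^ 2 := by
      positivity
    have h3 : ∫ s in Ioc 0 A, ‖truncTransform (hankelFun m) B g s‖ ^ 2 ≤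
        ∫ s in Ioi 0, ‖truncTransform (hankelFun m) B g s‖ ^ 2 :=
      setIntegral_mono_set (hT.integrableOn_norm_sq_truncTransform h0 B g)
        (Eventually.of_forall fun x => by positivity) (Eventually.of_forall fun x hx => hx.1)
    rw [← hT.norm_sq_apply_truncVec h0, hiso] at h3
    have h4 := pow_le_pow_left₀ (norm_nonneg _) (norm_truncVec_le B g) 2
    linarith
  have hint : Integrable (fun s => ‖truncTransform (hankelFun (m + 2)) B g s‖ ^ 2) posMeasure := by
    refine aecover_Ioc_zero.integrable_of_integral_norm_bounded (‖g‖ ^ 2)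
      (fun A => integrableOn_norm_sq_Ioc h2 A B g) ?_
    filter_upwards [eventually_ge_atTop 0] with A hA
    simpa using hle A hA
  refine ⟨(memLp_two_iff_integrable_sq_norm
    (h2.continuous_truncTransform (g.integrableOn_Ioc B)).aestronglyMeasurable).mpr hint, ?_⟩
  refine le_of_tendsto (aecover_Ioc_zero.integral_tendsto_of_countably_generated hint) ?_
  filter_upwards [eventually_ge_atTop 0] with A hA using hle A hA

/-- If the order is raised by `2`, the transform remains isometric: by the integrated contiguous
relation the loss of energy on `]0, A]` is at most of order `1 / A` for functions supported away
from `0` and `∞`. -/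
theorem norm_apply_hankelFun_add_two {m : ℕ} {T T' : L2Pos →L[ℂ] L2Pos}
    (hT : IsMeanTransform (hankelFun m) T) (hiso : ∀ g, ‖T g‖ = ‖g‖)
    (hT' : IsMeanTransform (hankelFun (m + 2)) T') (g : L2Pos) : ‖T' g‖ = ‖g‖ := by
  have h0 := isBddKernel_hankelFun m
  have h2 := isBddKernel_hankelFun (m + 2)
  refine norm_apply_eq_of_tendsto T' (tendsto_restrictVec aecover_Ioc_inv g) ?_
  filter_upwards [eventually_gt_atTop 0] with N hN
  set u : L2Pos := restrictVec (aecover_Ioc_inv.measurableSet N) g with hu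
  have hu0 : truncVec N u = u :=
    restrictVec_restrictVec measurableSet_Ioc (aecover_Ioc_inv.measurableSet N)
      (Ioc_subset_Ioc_left (inv_pos.mpr hN).le) g
  rw [← hiso u, ← hu0]
  refine (pow_left_inj₀ (norm_nonneg _) (norm_nonneg _) two_ne_zero).mp ?_
  rw [hT'.norm_sq_apply_truncVec h2, hT.norm_sq_apply_truncVec h0]
  have l0 := aecover_Ioc_zero.integral_tendsto_of_countably_generated
    (hT.integrableOn_norm_sq_truncTransform h0 N u)
  have l2 := aecover_Ioc_zero.integral_tendsto_of_countably_generated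
    (hT'.integrableOn_norm_sq_truncTransform h2 N u)
  simp only [posMeasure_restrict_Ioc] at l0 l2
  obtain ⟨C, hC0, hC⟩ := exists_abs_besselRealFun_le m
  set D : ℝ := ∫ y in Ioc (0 : ℝ) N, ‖u y‖
  have hloss : ∀ A, 0 < A →
      A * ‖∫ y in Ioc (0 : ℝ) N, (besselRealFun m (y * A) : ℂ) * u y‖ ^ 2 ≤
        (C * N * D) ^ 2 * A⁻¹ := fun A hA => by
    have hle : ‖∫ y in Ioc (0 : ℝ) N, (besselRealFun m (y * A) : ℂ) * u y‖ ≤ C * N / A * D := by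
      rw [← integral_const_mul]
      refine norm_integral_le_of_norm_le ((u.integrableOn_Ioc N).norm.const_mul _) ?_
      filter_upwards [ae_Ioc_of_ae_posMeasure
        (coeFn_restrictVec (aecover_Ioc_inv.measurableSet N) g) N] with y hy
      rw [norm_mul]
      by_cases hyN : y ∈ Ioc N⁻¹ N
      · refine mul_le_mul_of_nonneg_right ?_ (norm_nonneg _)
        rw [Complex.norm_real, Real.norm_eq_abs]
        have h1 := (hC (y * A)).2
        have hyA : A / N ≤ |y * A| := by
          rw [abs_of_pos (mul_pos ((inv_pos.mpr hN).trans hyN.1) hA), div_eq_inv_mul]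
          exact mul_le_mul_of_nonneg_right hyN.1.le hA.le
        rw [le_div_iff₀ hA]
        have h3 : A / N * |besselRealFun m (y * A)| ≤ C :=
          (mul_le_mul_of_nonneg_right hyA (abs_nonneg _)).trans h1
        rw [div_mul_eq_mul_div, div_le_iff₀ hN] at h3
        linarith
      · rw [hu, hy, indicator_of_notMem hyN, norm_zero, mul_zero, mul_zero]
    calc _ ≤ A * (C * N / A * D) ^ 2 :=
          mul_le_mul_of_nonneg_left (pow_le_pow_left₀ (norm_nonneg _) hle 2) hA.le
      _ = _ := by field_simp
  have lsub : Tendsto (fun A => (∫ s in Ioc (0 : ℝ) A, ‖truncTransform (hankelFun m) N u s‖ ^ 2) -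
      ∫ s in Ioc (0 : ℝ) A, ‖truncTransform (hankelFun (m + 2)) N u s‖ ^ 2) atTop (𝓝 0) := by
    have hlim : Tendsto (fun A : ℝ => (C * N * D) ^ 2 * A⁻¹) atTop (𝓝 0) := by
      simpa using tendsto_inv_atTop_zero.const_mul ((C * N * D) ^ 2)
    refine tendsto_of_tendsto_of_tendsto_of_le_of_le' tendsto_const_nhds hlim ?_ ?_
    · filter_upwards [eventually_ge_atTop 0] with A hA
      rw [integral_norm_sq_truncTransform_hankelFun_sub m hA (u.integrableOn_Ioc N)]
      positivity
    · filter_upwards [eventually_gt_atTop 0] with A hA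
      rw [integral_norm_sq_truncTransform_hankelFun_sub m hA.le (u.integrableOn_Ioc N)]
      exact hloss A hA
  exact (sub_eq_zero.mp (tendsto_nhds_unique (l0.sub l2) lsub)).symm

theorem exists_isometry_hankelFun (m : ℕ) :
    ∃ T : L2Pos →L[ℂ] L2Pos, IsMeanTransform (hankelFun m) T ∧ ∀ g, ‖T g‖ = ‖g‖ := by
  induction m using Nat.twoStepInduction with
  | zero =>
    exact exists_isometry_of_plancherel (isBddKernel_hankelFun 0) truncTransform_cos_plancherel
  | one =>
    exact exists_isometry_of_plancherel (isBddKernel_hankelFun 1) truncTransform_sin_plancherel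
  | more m h _ =>
    obtain ⟨T, hT, hiso⟩ := h
    obtain ⟨T', hT'⟩ :=
      (isContractive_hankelFun_add_two hT hiso).exists_isMeanTransform (isBddKernel_hankelFun _)
    exact ⟨T', hT', norm_apply_hankelFun_add_two hT hiso hT'⟩

/-! ### Comparison with the Bessel functions -/

theorem sqrt_mul_besselJ (m : ℕ) {x : ℝ} (hx : 0 < x) :
    (√x : ℂ) * besselJ ((m - 1 / 2 : ℝ) : ℂ) x = hankelFun m x := by
  have hpow : √x * (x / 2) ^ ((m : ℝ) - 1 / 2) = x ^ m * (√2 / 2 ^ m) := by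
    have h2 : √2 ≠ 0 := by positivity
    have hx' : √x ≠ 0 := (Real.sqrt_pos.mpr hx).ne'
    rw [Real.rpow_sub (by positivity), Real.rpow_natCast, ← Real.sqrt_eq_rpow,
      Real.sqrt_div hx.le, div_pow]
    field_simp
  have hc : ((x : ℂ) / 2) ^ ((m - 1 / 2 : ℝ) : ℂ) = (((x / 2) ^ ((m : ℝ) - 1 / 2) : ℝ) : ℂ) := by
    rw [Complex.ofReal_cpow (by positivity)]
    push_cast
    rfl
  rw [besselJ_eq, hc, hankelFun, Complex.ofReal_mul, ofReal_redBessel, ← mul_assoc,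
    ← Complex.ofReal_mul, hpow]
  push_cast
  ring

theorem hankelKernel_eq (m : ℕ) {s y : ℝ} (hs : 0 < s) (hy : 0 < y) :
    hankelKernel (m - 1 / 2) s y = hankelFun m (s * y) :=
  sqrt_mul_besselJ m (mul_pos hs hy)

theorem besselFun_eq (m : ℕ) {x : ℝ} (hx : 0 < x) :
    besselFun (m + 1 / 2) x = besselRealFun m x := by
  have h := sqrt_mul_besselJ (m + 1) hx
  have h2 := mul_besselRealFun m x
  have hx0 : (x : ℂ) ≠ 0 := by exact_mod_cast hx.ne'
  have hsx : (√x : ℂ) ≠ 0 := by exact_mod_cast (Real.sqrt_pos.mpr hx).ne'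
  have hss : (√x : ℂ) * √x = x := by exact_mod_cast Real.mul_self_sqrt hx.le
  rw [show (((m + 1 : ℕ) : ℝ) - 1 / 2) = m + 1 / 2 by push_cast; ring] at h
  refine mul_left_cancel₀ hx0 ?_
  rw [← Complex.ofReal_mul, h2, Complex.ofReal_mul, ← h,
    besselFun, show 2 * ((m : ℝ) + 1 / 2) = 2 * m + 1 by ring]
  field_simp
  rw [← hss]
  ring

/-- A continuous function that decays like `1 / x` is square integrable. -/
theorem memLp_two_of_decay {f : ℝ → ℂ} (hf : Continuous f) {C : ℝ}
    (hC : ∀ x, ‖f x‖ ≤ C ∧ |x| * ‖f x‖ ≤ C) : MemLp f 2 := by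
  rw [memLp_two_iff_integrable_sq_norm hf.aestronglyMeasurable]
  refine (integrable_inv_one_add_sq.const_mul (2 * C ^ 2)).mono'
    (hf.norm.pow 2).aestronglyMeasurable (Eventually.of_forall fun x => ?_)
  obtain ⟨h1, h2⟩ := hC x
  have h3 := pow_le_pow_left₀ (norm_nonneg _) h1 2
  have h4 := pow_le_pow_left₀ (by positivity) h2 2
  rw [mul_pow, sq_abs] at h4
  rw [Real.norm_of_nonneg (by positivity), ← div_eq_mul_inv, le_div_iff₀ (by positivity)]
  linarith

theorem memLp_besselRealFun (m : ℕ) :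
    MemLp (fun x => (besselRealFun m x : ℂ)) 2 posMeasure := by
  obtain ⟨C, -, hC⟩ := exists_abs_besselRealFun_le m
  exact (memLp_two_of_decay (Complex.continuous_ofReal.comp (continuous_besselRealFun m))
    (C := C) fun x => by simpa [Complex.norm_real] using hC x).restrict _

theorem besselFun_ae_eq (m : ℕ) :
    besselFun (m + 1 / 2) =ᵐ[posMeasure] fun x => (besselRealFun m x : ℂ) := by
  filter_upwards [ae_restrict_mem measurableSet_Ioi] with x hx
  exact besselFun_eq m hx

theorem memLp_besselFun (m : ℕ) : MemLp (besselFun (m + 1 / 2)) 2 posMeasure :=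
  (memLp_congr_ae (besselFun_ae_eq m)).mpr (memLp_besselRealFun m)

theorem coeFn_besselVec (m : ℕ) :
    besselVec (m + 1 / 2) =ᵐ[posMeasure] fun x => (besselRealFun m x : ℂ) := by
  rw [besselVec, dif_pos (memLp_besselFun m)]
  exact (memLp_besselFun m).coeFn_toLp.trans (besselFun_ae_eq m)

/-- The value at `0` of the even function `S_{m+1}` does not vanish, by the recurrence. -/
theorem besselVec_ne_zero (m : ℕ) : besselVec (m + 1 / 2) ≠ 0 := fun h => by
  have h1 := coeFn_besselVec m
  rw [h] at h1
  have h2 : (fun x => (besselRealFun m x : ℂ)) =ᵐ[volume.restrict (Ioi 0)] fun _ => (0 : ℂ) :=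
    h1.symm.trans (Lp.coeFn_zero _ _ _)
  have h3 : EqOn (fun x => (besselRealFun m x : ℂ)) (fun _ => 0) (Ioi 0) :=
    Measure.eqOn_open_of_ae_eq h2 isOpen_Ioi
      (Complex.continuous_ofReal.comp (continuous_besselRealFun m)).continuousOn continuousOn_const
  have h4 : EqOn (redBessel (m + 1)) (fun _ => 0) (Ioi 0) := fun x hx => by
    have h5 : besselRealFun m x = 0 := Complex.ofReal_eq_zero.mp (h3 hx)
    have hx' : (0 : ℝ) < x := hx
    simpa [besselRealFun, hx'.ne', (by positivity : √(2 * (m : ℝ) + 1) ≠ 0)] using h5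
  have h6 : redBessel (m + 1) 0 = 0 :=
    h4.of_subset_closure (continuous_redBessel _).continuousOn continuousOn_const
      Ioi_subset_Ici_self (by rw [closure_Ioi]) self_mem_Ici
  have h7 : ∀ n, redBessel n 0 ≠ 0 := fun n => by
    induction n with
    | zero =>
      rw [redBessel_zero, Real.cos_zero, mul_one]
      exact (Real.sqrt_pos.mpr (by positivity)).ne'
    | succ n ih =>
      intro h0
      have := redBessel_recurrence n 0
      rw [h0] at this
      apply ih
      linarith
  exact h7 _ h6

/-! ### Decreasing chains of projections with one-dimensional steps -/

section Chain

variable {H : Type*} [NormedAddCommGroup H] [InnerProductSpace ℂ H] {Q : ℕ → H →L[ℂ] H} {p : ℕ → H}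

/-- If orthogonal projections `Q n` satisfy `Q n - Q (n + 1) = ⟪p n, ·⟫ p n` with `p n ≠ 0`, then
the vectors `p n` are orthonormal: `Q (n + 1) ≤ Q n`, so the difference is a projection, whose
range is spanned by `p n`. -/
theorem orthonormal_of_projection_chain (hsym : ∀ n f g, inner ℂ (Q n f) g = inner ℂ f (Q n g))
    (hidem : ∀ n g, Q n (Q n g) = Q n g) (hp : ∀ n, p n ≠ 0)
    (hdiff : ∀ n g, Q n g - Q (n + 1) g = inner ℂ (p n) g • p n) : Orthonormal ℂ p := by
  have hsq : ∀ n g, inner ℂ g (Q n g) = ((‖Q n g‖ ^ 2 : ℝ) : ℂ) := fun n g => by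
    rw [← hidem, ← hsym, hidem, inner_self_eq_norm_sq_to_K]
    push_cast
    rfl
  have hpyth : ∀ n g, ‖Q n g‖ ^ 2 = ‖Q (n + 1) g‖ ^ 2 + ‖inner ℂ (p n) g‖ ^ 2 := fun n g => by
    have h := congrArg (inner ℂ g) (hdiff n g)
    rw [inner_sub_right, inner_smul_right, hsq, hsq, ← inner_conj_symm g (p n),
      Complex.mul_conj'] at h
    have h' : ‖Q n g‖ ^ 2 - ‖Q (n + 1) g‖ ^ 2 = ‖inner ℂ (p n) g‖ ^ 2 := by exact_mod_cast h
    linarith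
  -- Pythagoras: the kernel of `Q n` is contained in that of `Q (n + 1)` and orthogonal to `p n`
  have hker : ∀ n g, Q n g = 0 → Q (n + 1) g = 0 ∧ inner ℂ (p n) g = 0 := fun n g h => by
    have h1 := hpyth n g
    rw [h, norm_zero] at h1
    constructor
    · rw [← norm_eq_zero, ← sq_eq_zero_iff]
      nlinarith [sq_nonneg ‖Q (n + 1) g‖, sq_nonneg ‖inner ℂ (p n) g‖]
    · rw [← norm_eq_zero, ← sq_eq_zero_iff]
      nlinarith [sq_nonneg ‖Q (n + 1) g‖, sq_nonneg ‖inner ℂ (p n) g‖]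
  have hker' : ∀ n g, Q n (g - Q n g) = 0 := fun n g => by rw [map_sub, hidem, sub_self]
  have hfix : ∀ n, Q n (p n) = p n := fun n => by
    refine ext_inner_right ℂ fun g => ?_
    have h := (hker n _ (hker' n g)).2
    rw [inner_sub_right, sub_eq_zero] at h
    rw [hsym, h]
  have habs : ∀ n g, Q n (Q (n + 1) g) = Q (n + 1) g := fun n g => by
    refine ext_inner_right ℂ fun f => ?_
    have h := (hker n _ (hker' n f)).1
    rw [map_sub, sub_eq_zero] at h
    rw [hsym, hsym, ← h, ← hsym]
  have hstep : ∀ n, p n - Q (n + 1) (p n) = inner ℂ (p n) (p n) • p n := fun n => by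
    rw [← hdiff, hfix]
  have hpp : ∀ n, inner ℂ (p n) (p n) ≠ 0 := fun n => inner_self_ne_zero.mpr (hp n)
  -- apply `Q (n + 1)` to the preceding identity: the left-hand side vanishes
  have hzero : ∀ n, Q (n + 1) (p n) = 0 := fun n => by
    have h := congrArg (Q (n + 1)) (hstep n)
    rw [map_sub, hidem, sub_self, map_smul, eq_comm, smul_eq_zero] at h
    exact h.resolve_left (hpp n)
  have hnorm : ∀ n, ‖p n‖ = 1 := fun n => by
    have h := hstep n
    rw [hzero, sub_zero] at h
    have h1 : inner ℂ (p n) (p n) = 1 := by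
      have h2 : (inner ℂ (p n) (p n) - 1) • p n = 0 := by
        rw [sub_smul, one_smul, ← h, sub_self]
      exact sub_eq_zero.mp ((smul_eq_zero.mp h2).resolve_right (hp n))
    rw [inner_self_eq_norm_sq_to_K] at h1
    have h3 : ((‖p n‖ ^ 2 : ℝ) : ℂ) = 1 := by
      rw [Complex.ofReal_pow]
      exact h1
    exact (pow_eq_one_iff_of_nonneg (norm_nonneg _) two_ne_zero).mp (Complex.ofReal_eq_one.mp h3)
  have hmono : ∀ n k g, Q n (Q (n + k) g) = Q (n + k) g := fun n k => by
    induction k with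
    | zero => exact hidem n
    | succ k ih =>
      intro g
      rw [← add_assoc, ← habs (n + k) g, ih]
  have horth : ∀ n k, inner ℂ (p n) (p (n + 1 + k)) = 0 := fun n k => by
    rw [← hfix (n + 1 + k), ← hmono (n + 1) k, ← hsym, hzero, inner_zero_left]
  refine ⟨hnorm, fun i j hij => ?_⟩
  rcases lt_or_gt_of_ne hij with h | h
  · obtain ⟨k, rfl⟩ := Nat.exists_eq_add_of_le (Nat.succ_le_of_lt h)
    exact horth i k
  · obtain ⟨k, rfl⟩ := Nat.exists_eq_add_of_le (Nat.succ_le_of_lt h)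
    rw [← inner_conj_symm]
    simp only [Nat.succ_eq_add_one, horth, map_zero]

theorem hasSum_of_projection_chain [CompleteSpace H] (horth : Orthonormal ℂ p)
    (hdiff : ∀ n g, Q n g - Q (n + 1) g = inner ℂ (p n) g • p n) {g : H}
    (hlim : Tendsto (fun n => Q n g) atTop (𝓝 0)) :
    HasSum (fun n => inner ℂ (p n) g • p n) (Q 0 g) := by
  have hsum : Summable fun n => inner ℂ (p n) g • p n :=
    (horth.orthogonalFamily.summable_iff_norm_sq_summable fun n => inner ℂ (p n) g).mpr
      (horth.inner_products_summable g)
  rw [hsum.hasSum_iff_tendsto_nat]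
  have hpart : ∀ N, ∑ n ∈ Finset.range N, inner ℂ (p n) g • p n = Q 0 g - Q N g := fun N => by
    simp only [← hdiff]
    exact Finset.sum_range_sub' (fun n => Q n g) N
  simp only [hpart]
  simpa using (tendsto_const_nhds (x := Q 0 g)).sub hlim

end Chain

/-! ### Hankel transforms of the unit cutoff -/

/-- The Hankel transformation of order `m - 1/2`, defined by the analytic kernel. -/
noncomputable def halfHankel (m : ℕ) : L2Pos →L[ℂ] L2Pos :=
  meanIntegralTransform fun s y => (hankelFun m (s * y) : ℂ)

/-- The operator `H M(1_{[0,1]}) H`, where `H` is the Hankel transformation of order `m - 1/2`. -/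
noncomputable def hankelCutoff (m : ℕ) : L2Pos →L[ℂ] L2Pos :=
  halfHankel m ∘L unitCutoff ∘L halfHankel m

theorem isMeanTransform_halfHankel (m : ℕ) : IsMeanTransform (hankelFun m) (halfHankel m) := by
  obtain ⟨T, hT, -⟩ := exists_isometry_hankelFun m
  exact hT.meanIntegralTransform_spec

theorem IsMeanTransform.eq_halfHankel {m : ℕ} {T : L2Pos →L[ℂ] L2Pos}
    (hT : IsMeanTransform (hankelFun m) T) : T = halfHankel m :=
  IsMeanIntegralTransform.unique (fun A g => ((isBddKernel_hankelFun m).continuous_truncTransform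
    (g.integrableOn_Ioc A)).aestronglyMeasurable) hT (isMeanTransform_halfHankel m)

theorem norm_halfHankel (m : ℕ) (g : L2Pos) : ‖halfHankel m g‖ = ‖g‖ := by
  obtain ⟨T, hT, hiso⟩ := exists_isometry_hankelFun m
  rw [← hT.eq_halfHankel, hiso]

theorem halfHankel_halfHankel (m : ℕ) (g : L2Pos) : halfHankel m (halfHankel m g) = g :=
  (isMeanTransform_halfHankel m).apply_apply (isBddKernel_hankelFun m) (norm_halfHankel m) g

theorem isMeanIntegralTransform_hankel (m : ℕ) :
    IsMeanIntegralTransform (hankelKernel (m - 1 / 2)) (hankel (m - 1 / 2)) :=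
  ((isMeanTransform_halfHankel m).congr_kernel fun _ _ hs hy =>
    (hankelKernel_eq m hs hy).symm).meanIntegralTransform_spec

theorem hankel_eq_halfHankel (m : ℕ) : hankel (m - 1 / 2) = halfHankel m :=
  IsMeanTransform.eq_halfHankel ((isMeanIntegralTransform_hankel m).congr_kernel fun _ _ hs hy =>
    hankelKernel_eq m hs hy)

theorem cosKernel_eq : cosKernel = fun s y => (hankelFun 0 (s * y) : ℂ) := by
  ext s y
  rw [hankelFun_zero, cosKernel]

theorem sinKernel_eq : sinKernel = fun s y => (hankelFun 1 (s * y) : ℂ) := by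
  ext s y
  rw [hankelFun_one, sinKernel]

theorem fourierCos_eq : fourierCos = halfHankel 0 := by rw [fourierCos, cosKernel_eq, halfHankel]

theorem fourierSin_eq : fourierSin = halfHankel 1 := by rw [fourierSin, sinKernel_eq, halfHankel]

theorem unitCutoff_apply (g : L2Pos) : unitCutoff g = truncVec 1 g := by
  refine Lp.ext ?_
  have h1 : unitCutoff g =ᵐ[posMeasure] fun x =>
      indicatorConstLp ∞ measurableSet_Icc posMeasure_Icc_ne_top (1 : ℂ) x * g x :=
    (ContinuousLinearMap.mul ℂ ℂ).coeFn_holder _ g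
  filter_upwards [h1, coeFn_restrictVec (measurableSet_Ioc (a := 0) (b := 1)) g,
    indicatorConstLp_coeFn (p := ∞) (hs := measurableSet_Icc) (hμs := posMeasure_Icc_ne_top)
      (c := (1 : ℂ)), ae_restrict_mem measurableSet_Ioi] with x h1 h2 h3 hx
  have hx : (0 : ℝ) < x := hx
  rw [h1, h3, truncVec, h2]
  by_cases hx1 : x ≤ 1
  · rw [indicator_of_mem (show x ∈ Icc 0 1 from ⟨hx.le, hx1⟩),
      indicator_of_mem (show x ∈ Ioc 0 1 from ⟨hx, hx1⟩), one_mul]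
  · rw [indicator_of_notMem fun h => hx1 h.2, indicator_of_notMem fun h => hx1 h.2, zero_mul]

theorem hankelCutoff_apply (m : ℕ) (g : L2Pos) :
    hankelCutoff m g = halfHankel m (truncVec 1 (halfHankel m g)) := by
  rw [← unitCutoff_apply]
  rfl

theorem inner_truncVec_left (A : ℝ) (f g : L2Pos) :
    inner ℂ (truncVec A f) g = inner ℂ f (truncVec A g) := by
  rw [← inner_conj_symm, inner_truncVec_right, inner_truncVec_right]
  refine (integral_conj (𝕜 := ℂ)).symm.trans (integral_congr_ae (Eventually.of_forall fun y => ?_))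
  simp [mul_comm]

theorem truncVec_truncVec (A : ℝ) (g : L2Pos) : truncVec A (truncVec A g) = truncVec A g :=
  restrictVec_restrictVec _ _ subset_rfl g

theorem hankelCutoff_symm (m : ℕ) (f g : L2Pos) :
    inner ℂ (hankelCutoff m f) g = inner ℂ f (hankelCutoff m g) := by
  have h := (isMeanTransform_halfHankel m).inner_apply_left (isBddKernel_hankelFun m)
  rw [hankelCutoff_apply, hankelCutoff_apply, h, inner_truncVec_left, h]

theorem hankelCutoff_idem (m : ℕ) (g : L2Pos) :
    hankelCutoff m (hankelCutoff m g) = hankelCutoff m g := by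
  simp only [hankelCutoff_apply, halfHankel_halfHankel, truncVec_truncVec]

theorem norm_hankelCutoff_le (m : ℕ) (g : L2Pos) : ‖hankelCutoff m g‖ ≤ ‖g‖ := by
  rw [hankelCutoff_apply, norm_halfHankel, ← norm_halfHankel m g]
  exact norm_truncVec_le 1 _

theorem hankelCutoff_truncVec (m : ℕ) (B : ℝ) (g : L2Pos) :
    hankelCutoff m (truncVec B g) =ᵐ[posMeasure]
      truncTransform (hankelFun m) 1 (truncTransform (hankelFun m) B g) := by
  have hT := isMeanTransform_halfHankel m
  have hκ := isBddKernel_hankelFun m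
  rw [hankelCutoff_apply, ← truncTransform_congr (hT.apply_truncVec hκ B g)]
  exact hT.apply_truncVec hκ 1 _

/-- The projections `H M(1_{[0,1]}) H` of orders that differ by `2` differ by an operator of rank
one. -/
theorem hankelCutoff_sub (m : ℕ) (g : L2Pos) :
    hankelCutoff m g - hankelCutoff (m + 2) g =
      inner ℂ (besselVec (m + 1 / 2)) g • besselVec (m + 1 / 2) := by
  have htrunc : ∀ B, hankelCutoff m (truncVec B g) - hankelCutoff (m + 2) (truncVec B g) =
      inner ℂ (besselVec (m + 1 / 2)) (truncVec B g) • besselVec (m + 1 / 2) := fun B => by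
    have hinner : inner ℂ (besselVec (m + 1 / 2)) (truncVec B g) =
        ∫ y in Ioc (0 : ℝ) B, (besselRealFun m (y * 1) : ℂ) * g y := by
      rw [inner_truncVec_right]
      refine integral_congr_ae ?_
      filter_upwards [ae_Ioc_of_ae_posMeasure (coeFn_besselVec m) B] with y hy
      rw [hy, mul_one, mul_comm]
      congr 1
      exact Complex.conj_ofReal _
    refine Lp.ext ?_
    filter_upwards [Lp.coeFn_sub (hankelCutoff m (truncVec B g))
      (hankelCutoff (m + 2) (truncVec B g)), hankelCutoff_truncVec m B g,
      hankelCutoff_truncVec (m + 2) B g, Lp.coeFn_smul (inner ℂ (besselVec (m + 1 / 2))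
      (truncVec B g)) (besselVec (m + 1 / 2)), coeFn_besselVec m] with x h1 h2 h3 h4 h5
    rw [h1, Pi.sub_apply, h2, h3, h4, Pi.smul_apply, h5,
      truncTransform_truncTransform_hankelFun_sub m zero_le_one (g.integrableOn_Ioc B), hinner,
      smul_eq_mul, mul_one, Complex.ofReal_one, one_mul, mul_comm]
  have ht := tendsto_truncVec g
  have hl := (((hankelCutoff m).continuous.tendsto g).comp ht).sub
    (((hankelCutoff (m + 2)).continuous.tendsto g).comp ht)
  have hr := (((tendsto_const_nhds (x := besselVec (m + 1 / 2))).inner ht (𝕜 := ℂ))).smul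
    (tendsto_const_nhds (x := besselVec (m + 1 / 2)))
  exact tendsto_nhds_unique (hl.congr fun B => htrunc B) hr

/-- The kernels of the transforms tend to `0` locally uniformly as the order tends to infinity. -/
theorem tendsto_hankelCutoff_truncVec {B : ℝ} (hB : 0 ≤ B) (g : L2Pos) :
    Tendsto (fun m => hankelCutoff m (truncVec B g)) atTop (𝓝 0) := by
  set D : ℝ := ∫ y in Ioc (0 : ℝ) B, ‖g y‖
  have hD : 0 ≤ D := integral_nonneg fun y => norm_nonneg _
  have hle : ∀ m : ℕ, ‖hankelCutoff m (truncVec B g)‖ ≤ B ^ m / m ! * D := fun m => by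
    have hκ := isBddKernel_hankelFun m
    refine (pow_le_pow_iff_left₀ (norm_nonneg _) (by positivity) two_ne_zero).mp ?_
    rw [hankelCutoff_apply, norm_halfHankel, norm_sq_truncVec]
    have hpt : ∀ s ∈ Ioc (0 : ℝ) 1, ‖truncTransform (hankelFun m) B g s‖ ≤ B ^ m / m ! * D :=
      fun s hs => by
      rw [← integral_const_mul]
      refine norm_integral_le_of_norm_le ((g.integrableOn_Ioc B).norm.const_mul _) ?_
      filter_upwards [ae_restrict_mem measurableSet_Ioc] with y hy
      rw [norm_mul, Complex.norm_real]
      refine mul_le_mul_of_nonneg_right ((abs_hankelFun_le m _).trans ?_) (norm_nonneg _)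
      gcongr
      rw [abs_of_nonneg (mul_nonneg hs.1.le hy.1.le)]
      nlinarith [hs.1, hs.2, hy.1, hy.2]
    calc ∫ s in Ioc (0 : ℝ) 1, ‖halfHankel m (truncVec B g) s‖ ^ 2
        = ∫ s in Ioc (0 : ℝ) 1, ‖truncTransform (hankelFun m) B g s‖ ^ 2 := by
          refine integral_congr_ae ?_
          filter_upwards [ae_Ioc_of_ae_posMeasure
            ((isMeanTransform_halfHankel m).apply_truncVec hκ B g) 1] with s hs
          rw [hs]
      _ ≤ ∫ s in Ioc (0 : ℝ) 1, (B ^ m / m ! * D) ^ 2 := by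
          refine setIntegral_mono_on ((hκ.continuous_truncTransform
            (g.integrableOn_Ioc B)).norm.pow 2).integrableOn_Ioc
            (continuous_const.integrableOn_Ioc) measurableSet_Ioc fun s hs => ?_
          exact pow_le_pow_left₀ (norm_nonneg _) (hpt s hs) 2
      _ = (B ^ m / m ! * D) ^ 2 := by simp
  have hlim := (FloorSemiring.tendsto_pow_div_factorial_atTop B).mul_const D
  rw [zero_mul] at hlim
  exact squeeze_zero_norm hle hlim

theorem tendsto_hankelCutoff (g : L2Pos) : Tendsto (fun m => hankelCutoff m g) atTop (𝓝 0) := by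
  rw [Metric.tendsto_nhds]
  intro ε hε
  obtain ⟨B, hB, hB0⟩ := ((Metric.tendsto_nhds.mp (tendsto_truncVec g) (ε / 2) (half_pos hε)).and
    (eventually_ge_atTop 0)).exists
  filter_upwards [Metric.tendsto_nhds.mp (tendsto_hankelCutoff_truncVec hB0 g) (ε / 2)
    (half_pos hε)] with m hm
  rw [dist_zero_right] at hm ⊢
  rw [dist_comm, dist_eq_norm] at hB
  have h1 : hankelCutoff m g =
      hankelCutoff m (g - truncVec B g) + hankelCutoff m (truncVec B g) := by
    rw [map_sub, sub_add_cancel]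
  rw [h1]
  linarith [norm_add_le (hankelCutoff m (g - truncVec B g)) (hankelCutoff m (truncVec B g)),
    norm_hankelCutoff_le m (g - truncVec B g)]

theorem orthonormal_besselVec (i : ℕ) :
    Orthonormal ℂ fun n : ℕ => besselVec ((2 * n + i : ℕ) + 1 / 2) :=
  orthonormal_of_projection_chain (Q := fun n => hankelCutoff (2 * n + i))
    (fun _ => hankelCutoff_symm _) (fun _ => hankelCutoff_idem _) (fun _ => besselVec_ne_zero _)
    fun n g => by
      rw [show 2 * (n + 1) + i = 2 * n + i + 2 by ring]
      exact hankelCutoff_sub (2 * n + i) g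

theorem norm_besselVec (m : ℕ) : ‖besselVec (m + 1 / 2)‖ = 1 := by
  simpa using (orthonormal_besselVec m).1 0

theorem besselProj_apply (m : ℕ) (g : L2Pos) :
    besselProj (m + 1 / 2) g = inner ℂ (besselVec (m + 1 / 2)) g • besselVec (m + 1 / 2) :=
  Submodule.starProjection_unit_singleton ℂ (norm_besselVec m) g

theorem hasSum_besselProj (i : ℕ) (g : L2Pos) :
    HasSum (fun n : ℕ => besselProj ((2 * n + i : ℕ) + 1 / 2) g) (hankelCutoff i g) := by
  simp only [besselProj_apply]
  have hlim : Tendsto (fun n : ℕ => hankelCutoff (2 * n + i) g) atTop (𝓝 0) :=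
    (tendsto_hankelCutoff g).comp
      (tendsto_atTop_mono (fun n => by simp only [id]; omega) tendsto_id)
  have h := hasSum_of_projection_chain (Q := fun n => hankelCutoff (2 * n + i))
    (orthonormal_besselVec i) (fun n g => by
      rw [show 2 * (n + 1) + i = 2 * n + i + 2 by ring]
      exact hankelCutoff_sub (2 * n + i) g) hlim
  simpa using h

/-- The orders of the projections in the sum are `m + 2k + 1/2`, for `k < N`. -/
theorem hankelCutoff_add_two_mul (m N : ℕ) :
    hankelCutoff (m + 2 * N) = hankelCutoff m -
      ∑ k ∈ Finset.range N, besselProj ((m + 2 * k : ℕ) + 1 / 2) := by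
  induction N with
  | zero => simp
  | succ N ih =>
    rw [Finset.sum_range_succ, ← sub_sub, ← ih]
    ext1 g
    rw [sub_apply, besselProj_apply, ← hankelCutoff_sub, sub_sub_cancel]
    rfl

/-! ### The Wiener-Hopf operator with sinc kernel -/

theorem integral_cos_mul_eq_sinc (a : ℝ) : ∫ t in (0 : ℝ)..1, Real.cos (a * t) = Real.sinc a := by
  rcases eq_or_ne a 0 with rfl | ha
  · simp
  · rw [intervalIntegral.integral_comp_mul_left Real.cos ha, integral_cos, mul_zero, mul_one,
      Real.sin_zero, sub_zero, Real.sinc_of_ne_zero ha, smul_eq_mul, inv_mul_eq_div]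

theorem sincKernel_eq (x y : ℝ) :
    sincKernel x y = (1 / 2 : ℂ) *
      (truncTransform (hankelFun 0) 1 (fun t => (hankelFun 0 (x * t) : ℂ)) y +
        truncTransform (hankelFun 1) 1 (fun t => (hankelFun 1 (x * t) : ℂ)) y) := by
  rw [sincKernel, ← integral_cos_mul_eq_sinc, intervalIntegral.integral_of_le zero_le_one,
    Complex.ofReal_mul, ← integral_complex_ofReal, truncTransform, truncTransform, ← integral_add
    ((isBddKernel_hankelFun 0).integrableOn_mul ((isBddKernel_hankelFun 0).integrableOn_Ioc x 1) y)
    ((isBddKernel_hankelFun 1).integrableOn_mul ((isBddKernel_hankelFun 1).integrableOn_Ioc x 1) y),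
    ← integral_const_mul, ← integral_const_mul]
  refine integral_congr_ae (Eventually.of_forall fun t => ?_)
  have hs : √(2 / Real.pi) * √(2 / Real.pi) = 2 / Real.pi := Real.mul_self_sqrt (by positivity)
  have hreal : 1 / Real.pi * Real.cos ((x - y) * t) =
      1 / 2 * (hankelFun 0 (y * t) * hankelFun 0 (x * t) +
        hankelFun 1 (y * t) * hankelFun 1 (x * t)) := by
    rw [hankelFun_zero, hankelFun_zero, hankelFun_one, hankelFun_one, sub_mul, Real.cos_sub]
    linear_combination (-1 / 2) * (Real.cos (y * t) * Real.cos (x * t) +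
      Real.sin (y * t) * Real.sin (x * t)) * hs
  have := congrArg (fun r : ℝ => (r : ℂ)) hreal
  push_cast at this ⊢
  exact this

theorem memLp_sincKernel (x : ℝ) : MemLp (sincKernel x) 2 posMeasure := by
  have hcont : Continuous (sincKernel x) := Complex.continuous_ofReal.comp
    (continuous_const.mul (Real.continuous_sinc.comp (continuous_const.sub continuous_id)))
  have hpi : 1 / Real.pi ≤ 1 := by
    rw [div_le_one Real.pi_pos]
    linarith [Real.two_le_pi]
  refine (memLp_two_of_decay hcont (C := 1 + |x|) fun y => ?_).restrict _
  have h1 := Real.abs_sinc_le_one (x - y)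
  have hn : ‖sincKernel x y‖ ≤ |Real.sinc (x - y)| := by
    rw [sincKernel, Complex.norm_real, Real.norm_eq_abs, abs_mul, abs_of_pos (by positivity)]
    exact mul_le_of_le_one_left (abs_nonneg _) hpi
  have h2 : |x - y| * |Real.sinc (x - y)| ≤ 1 := by
    rcases eq_or_ne (x - y) 0 with h | h
    · simp [h]
    · rw [← abs_mul, Real.sinc_of_ne_zero h, mul_div_cancel₀ _ h]
      exact Real.abs_sin_le_one _
  refine ⟨by linarith [abs_nonneg x], ?_⟩
  have h3 : |y| ≤ |x - y| + |x| := by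
    have := abs_sub_abs_le_abs_sub y x
    rw [abs_sub_comm y x] at this
    linarith
  calc |y| * ‖sincKernel x y‖ ≤ (|x - y| + |x|) * |Real.sinc (x - y)| := by gcongr
    _ ≤ 1 + |x| := by nlinarith [abs_nonneg x]

theorem integrableOn_sincKernel_mul (x : ℝ) (g : L2Pos) :
    IntegrableOn (fun y => sincKernel x y * g y) (Ioi 0) :=
  (memLp_sincKernel x).integrable_mul (Lp.memLp g)

theorem isIntegralOperator_sinc :
    IsIntegralOperator sincKernel ((1 / 2 : ℂ) • (hankelCutoff 0 + hankelCutoff 1)) := fun g => by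
  set K : L2Pos →L[ℂ] L2Pos := (1 / 2 : ℂ) • (hankelCutoff 0 + hankelCutoff 1) with hK
  refine ⟨fun x _ => integrableOn_sincKernel_mul x g, ?_⟩
  have htrunc : ∀ B : ℝ, ∀ᵐ x ∂posMeasure, K (truncVec B g) x =
      ∫ y in Ioc (0 : ℝ) B, sincKernel x y * g y := fun B => by
    have hg := g.integrableOn_Ioc B
    have h0 := isBddKernel_hankelFun 0
    have h1 := isBddKernel_hankelFun 1
    filter_upwards [hankelCutoff_truncVec 0 B g, hankelCutoff_truncVec 1 B g,
      Lp.coeFn_add (hankelCutoff 0 (truncVec B g)) (hankelCutoff 1 (truncVec B g)),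
      Lp.coeFn_smul (1 / 2 : ℂ) (hankelCutoff 0 (truncVec B g) + hankelCutoff 1 (truncVec B g))]
      with x e0 e1 eadd esmul
    have : K (truncVec B g) =
      (1 / 2 : ℂ) • (hankelCutoff 0 (truncVec B g) + hankelCutoff 1 (truncVec B g)) := rfl
    rw [this, esmul, Pi.smul_apply, eadd, Pi.add_apply, e0, e1,
      h0.truncTransform_truncTransform hg, h1.truncTransform_truncTransform hg, smul_eq_mul,
      ← integral_add (h0.integrableOn_mul_truncTransform hg (h0.integrableOn_Ioc x 1))
      (h1.integrableOn_mul_truncTransform hg (h1.integrableOn_Ioc x 1)), ← integral_const_mul]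
    refine integral_congr_ae (Eventually.of_forall fun y => ?_)
    simp only [sincKernel_eq]
    ring
  have hK : Tendsto (fun n : ℕ => K (truncVec n g)) atTop (𝓝 (K g)) :=
    (K.continuous.tendsto g).comp ((tendsto_truncVec g).comp tendsto_natCast_atTop_atTop)
  obtain ⟨ns, hns, hlim⟩ := (tendstoInMeasure_of_tendsto_Lp hK).exists_seq_tendsto_ae
  filter_upwards [hlim, ae_all_iff.mpr fun n : ℕ => htrunc n] with x hx hx'
  refine tendsto_nhds_unique hx ?_
  simp only [hx']
  have hint := aecover_Ioc_zero.integral_tendsto_of_countably_generated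
    (integrableOn_sincKernel_mul x g)
  simp only [posMeasure_restrict_Ioc] at hint
  exact hint.comp (tendsto_natCast_atTop_atTop.comp hns.tendsto_atTop)

theorem isIntegralOperator_sincOperator : IsIntegralOperator sincKernel sincOperator := by
  have h : ∃ T, IsIntegralOperator sincKernel T := ⟨_, isIntegralOperator_sinc⟩
  rw [sincOperator, integralOperator, dif_pos h]
  exact h.choose_spec

theorem sincOperator_eq :
    sincOperator = (1 / 2 : ℂ) • (hankelCutoff 0 + hankelCutoff 1) := by
  ext1 g
  refine Lp.ext ?_
  filter_upwards [(isIntegralOperator_sincOperator g).2, (isIntegralOperator_sinc g).2] with x h1 h2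
  rw [h1, h2]

theorem mainTheorem6 :
    -- the operators and functions in question exist
    (IsIntegralOperator sincKernel sincOperator ∧
      IsMeanIntegralTransform cosKernel fourierCos ∧
      IsMeanIntegralTransform sinKernel fourierSin ∧
      (∀ m : ℕ, IsMeanIntegralTransform (hankelKernel (m - 1 / 2)) (hankel (m - 1 / 2))) ∧
      (∀ m : ℕ, MemLp (besselFun (m + 1 / 2)) 2 posMeasure)) ∧
    -- (i)
    sincOperator = (1 / 2 : ℂ) •
      (fourierCos ∘L unitCutoff ∘L fourierCos + fourierSin ∘L unitCutoff ∘L fourierSin) ∧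
    -- (ii)
    ((Orthonormal ℂ (fun n : ℕ => besselVec (2 * n + 1 / 2)) ∧
        ∀ g : L2Pos, HasSum (fun n : ℕ => besselProj (2 * n + 1 / 2) g)
          ((fourierCos ∘L unitCutoff ∘L fourierCos) g)) ∧
      (Orthonormal ℂ (fun n : ℕ => besselVec (2 * n + 3 / 2)) ∧
        ∀ g : L2Pos, HasSum (fun n : ℕ => besselProj (2 * n + 3 / 2) g)
          ((fourierSin ∘L unitCutoff ∘L fourierSin) g))) ∧
    -- (iii)
    (∀ n i : ℕ, i ≤ 1 →
      hankel (2 * n + i + 1 / 2) ∘L unitCutoff ∘L hankel (2 * n + i + 1 / 2) =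
        hankel (1 / 2 - i) ∘L unitCutoff ∘L hankel (1 / 2 - i) -
          ∑ k ∈ Finset.range (n + i), besselProj (2 * k - i + 3 / 2)) ∧
    -- the telescoping identity
    (∀ (ν a b z : ℂ) (n n' : ℤ), a * b ≠ 0 → n ≤ n' →
      ((∃ m : ℤ, ν = m) ∨ (a * z ∈ Complex.slitPlane ∧ b * z ∈ Complex.slitPlane)) →
      HasDerivAt
        (fun w : ℂ => ∑ k ∈ Finset.Icc n n',
          2 * (ν + 2 * k) * (a * b)⁻¹ * besselJ (ν + 2 * k) (a * w) * besselJ (ν + 2 * k) (b * w))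
        (z * (besselJ (ν + 2 * n - 1) (a * z) * besselJ (ν + 2 * n - 1) (b * z) -
          besselJ (ν + 2 * n' + 1) (a * z) * besselJ (ν + 2 * n' + 1) (b * z))) z) := by
  have hthree : ∀ n : ℕ, 2 * (n : ℝ) + 1 + 1 / 2 = 2 * n + 3 / 2 := fun n => by ring
  refine ⟨⟨isIntegralOperator_sincOperator, ?_, ?_, isMeanIntegralTransform_hankel,
    memLp_besselFun⟩, ?_, ⟨⟨?_, fun g => ?_⟩, ?_, fun g => ?_⟩, ?_, ?_⟩
  · rw [fourierCos_eq, cosKernel_eq]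
    exact isMeanTransform_halfHankel 0
  · rw [fourierSin_eq, sinKernel_eq]
    exact isMeanTransform_halfHankel 1
  · rw [sincOperator_eq, fourierCos_eq, fourierSin_eq]
    rfl
  · simpa using orthonormal_besselVec 0
  · rw [fourierCos_eq]
    have h := hasSum_besselProj 0 g
    simp only [Nat.cast_mul, Nat.cast_ofNat, add_zero] at h
    exact h
  · have h := orthonormal_besselVec 1
    simp only [Nat.cast_add, Nat.cast_mul, Nat.cast_ofNat, Nat.cast_one, hthree] at h
    exact h
  · rw [fourierSin_eq]
    have h := hasSum_besselProj 1 g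
    simp only [Nat.cast_add, Nat.cast_mul, Nat.cast_ofNat, Nat.cast_one, hthree] at h
    exact h
  · intro n i hi
    have h := hankel_eq_halfHankel (2 * n + i + 1)
    rw [show ((2 * n + i + 1 : ℕ) : ℝ) - 1 / 2 = 2 * n + i + 1 / 2 by push_cast; ring] at h
    rw [h]
    rcases Nat.le_one_iff_eq_zero_or_eq_one.mp hi with rfl | rfl
    · have h1 := hankel_eq_halfHankel 1
      have hc := hankelCutoff_add_two_mul 1 n
      rw [show ((1 : ℕ) : ℝ) - 1 / 2 = 1 / 2 - (0 : ℕ) by norm_num] at h1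
      rw [h1, show 2 * n + 0 + 1 = 1 + 2 * n by ring]
      refine hc.trans (congrArg _ (Finset.sum_congr rfl fun k _ => ?_))
      congr 1
      push_cast
      ring
    · have h0 := hankel_eq_halfHankel 0
      have hc := hankelCutoff_add_two_mul 0 (n + 1)
      rw [show ((0 : ℕ) : ℝ) - 1 / 2 = 1 / 2 - (1 : ℕ) by norm_num] at h0
      rw [h0, show 2 * n + 1 + 1 = 0 + 2 * (n + 1) by ring]
      refine hc.trans (congrArg _ (Finset.sum_congr rfl fun k _ => ?_))
      congr 1
      push_cast
      ring
  · intro ν a b z n n' hab hn h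
    exact hasDerivAt_sum_besselJ_mul_besselJ hab hn (h.imp_right And.left) (h.imp_right And.right)
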